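/- **Proposition.** Let $\mathsf{RCA}_0^*$ be the theory in the language of second-order arithmetic with symbols $0,1,+,\cdot,\exp,<,=,\in$ (classical two-sorted logic, variables for natural numbers and for sets of natural numbers) whose axioms are the universal closures of: the basic axioms $n+1\neq 0$; $m+1=n+1\to m=n$; $m+0=m$; $m+(n+1)=(m+n)+1$; $m\cdot 0=0$; $m\cdot(n+1)=m\cdot n+m$; $m^0=1$; $m^{n+1}=m^n\cdot m$; $\neg\, m<0$; $m<n+1\leftrightarrow(m<n\vee m=n)$; induction $\varphi(0)\wedge\forall n(\varphi(n)\to\varphi(n+1))\to\forall n\,\varphi(n)$ for every $\Sigma^0_0$ formula $\varphi$ (all quantifiers are number quantifiers bounded by terms of the language; parameters allowed); and $\Delta^0_1$ comprehension $\forall n(\varphi(n)\leftrightarrow\psi(n))\to\exists X\forall n(n\in X\leftrightarrow\varphi(n))$ for every $\Sigma^0_1$ formula $\varphi$ in which $X$ is not free and every $\Pi^0_1$ formula $\psi$. A set $X\subseteq\mathbb N$ *has gaps bounded by $d$* if $y-x\le d$ whenever $x<y$ are consecutive elements of $X$. The set $X$ is *finite* if it is bounded and *infinite* otherwise, and a finite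 set *has $n$ elements* if there is a strictly increasing function from $\{i: i<n\}$ onto it. The set $X$ is * *syndetic* if $X$ is infinite and there exists $d$ such that $X$ has gaps bounded by $d$; * *thick* if $X$ contains arbitrarily long intervals: for every $n$ there is $a$ with $a+i\in X$ for all $i<n$; * *piecewise syndetic* if there exists $d$ such that for every $n$ there is a finite set $H\subseteq X$ with at least $n$ elements and with gaps bounded by $d$. Then $\mathsf{RCA}_0^*$ proves the sentence: for every set $X\subseteq\mathbb N$, the following are equivalent: 1. $X$ is piecewise syndetic; 2. there are a syndetic set $Y$ and a thick set $Z$ such that $X=Y\cap Z$. -/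

import Mathlib

/-!
Second-order arithmetic with exponentiation: syntax, a deductive calculus, the theory `RCA₀*`,
and the formulas saying that a set of natural numbers is syndetic, thick, piecewise syndetic.

Variables are de Bruijn indices.  There are two independent families, one for numbers and one for
sets, so a number quantifier does not change the index of a set variable and vice versa.
-/

namespace SecondOrderArith

/-! ### Syntax -/

/-- Numerical terms of `L₂(exp)`. -/
inductive Tm : Type
  | var : ℕ → Tm
  | zero : Tm
  | one : Tm
  | add : Tm → Tm → Tm
  | mul : Tm → Tm → Tm
  | exp : Tm → Tm → Tm

/-- Formulas of `L₂(exp)`.  As usual there is no primitive equality between sets.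
`all` binds a number variable, `allS` binds a set variable. -/
inductive Fm : Type
  | eq : Tm → Tm → Fm
  | lt : Tm → Tm → Fm
  | mem : Tm → ℕ → Fm
  | bot : Fm
  | imp : Fm → Fm → Fm
  | all : Fm → Fm
  | allS : Fm → Fm

instance : Zero Tm := ⟨Tm.zero⟩
instance : One Tm := ⟨Tm.one⟩
instance : Add Tm := ⟨Tm.add⟩
instance : Mul Tm := ⟨Tm.mul⟩

prefix:max "#" => Tm.var
infix:50 "≐" => Fm.eq
infix:50 "≺" => Fm.lt
infix:50 "∊" => Fm.mem
infixr:30 "⟹" => Fm.imp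

namespace Fm

/-- Negation. -/
def neg (φ : Fm) : Fm := φ ⟹ bot

/-- Conjunction. -/
def and (φ ψ : Fm) : Fm := neg (φ ⟹ neg ψ)

/-- Disjunction. -/
def or (φ ψ : Fm) : Fm := neg φ ⟹ ψ

/-- Equivalence. -/
def iff (φ ψ : Fm) : Fm := and (φ ⟹ ψ) (ψ ⟹ φ)

/-- Existential number quantifier. -/
def ex (φ : Fm) : Fm := neg (all (neg φ))

/-- Existential set quantifier. -/
def exS (φ : Fm) : Fm := neg (allS (neg φ))

end Fm

infixr:35 "⋏" => Fm.and
infixr:33 "⋎" => Fm.or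
infix:25 "⟺" => Fm.iff

/-- `s ≤ t`. -/
def Fm.le (s t : Tm) : Fm := s ≺ t ⋎ s ≐ t

infix:50 "≼" => Fm.le

/-! ### Substitution -/

/-- Simultaneous substitution of terms for number variables. -/
def Tm.subst (σ : ℕ → Tm) : Tm → Tm
  | var i => σ i
  | zero => zero
  | one => one
  | add s t => add (s.subst σ) (t.subst σ)
  | mul s t => mul (s.subst σ) (t.subst σ)
  | exp s t => exp (s.subst σ) (t.subst σ)

/-- Weakening of a term by one number variable. -/
def Tm.shift (t : Tm) : Tm := t.subst fun i => #(i + 1)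

/-- Passing a number substitution under a number quantifier. -/
def upTm (σ : ℕ → Tm) : ℕ → Tm
  | 0 => #0
  | i + 1 => (σ i).shift

/-- Passing a renaming of set variables under a set quantifier. -/
def upSet (ρ : ℕ → ℕ) : ℕ → ℕ
  | 0 => 0
  | i + 1 => ρ i + 1

namespace Fm

/-- Simultaneous capture-avoiding substitution: terms `σ` for the free number variables and
set variables `ρ` for the free set variables. -/
def subst : (ℕ → Tm) → (ℕ → ℕ) → Fm → Fm
  | σ, _, eq s t => eq (s.subst σ) (t.subst σ)
  | σ, _, lt s t => lt (s.subst σ) (t.subst σ)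
  | σ, ρ, mem t X => mem (t.subst σ) (ρ X)
  | _, _, bot => bot
  | σ, ρ, imp φ ψ => imp (subst σ ρ φ) (subst σ ρ ψ)
  | σ, ρ, all φ => all (subst (upTm σ) ρ φ)
  | σ, ρ, allS φ => allS (subst σ (upSet ρ) φ)

/-- Weakening by one number variable. -/
def shift (φ : Fm) : Fm := φ.subst (fun i => #(i + 1)) id

/-- Weakening by one set variable. -/
def shiftS (φ : Fm) : Fm := φ.subst Tm.var (fun X => X + 1)

/-- `φ(t)`: instantiate number variable `0` by `t` and lower the others. -/
def inst (φ : Fm) (t : Tm) : Fm := φ.subst (fun | 0 => t | i + 1 => #i) id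

/-- `φ(Y)`: instantiate set variable `0` by the set variable `Y` and lower the others. -/
def instS (φ : Fm) (Y : ℕ) : Fm := φ.subst Tm.var (fun | 0 => Y | X + 1 => X)

/-- `φ(n + 1)` as a formula in the same variables as `φ(n)`, where `n` is number variable `0`. -/
def succInst (φ : Fm) : Fm := φ.subst (fun | 0 => #0 + 1 | i + 1 => #(i + 1)) id

end Fm

/-! ### Provability -/

/-- `Derives T Γ φ`: classical two-sorted natural deduction with equality on numbers; `Γ` lists the
open assumptions.  The axioms in `T` stand for their universal closures, so each instance of them
may be used. -/
inductive Derives (T : Set Fm) : List Fm → Fm → Prop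
  | ax {Γ : List Fm} {φ : Fm} (σ : ℕ → Tm) (ρ : ℕ → ℕ) : φ ∈ T → Derives T Γ (φ.subst σ ρ)
  | hyp {Γ : List Fm} {φ : Fm} : φ ∈ Γ → Derives T Γ φ
  | impI {Γ : List Fm} {φ ψ : Fm} : Derives T (φ :: Γ) ψ → Derives T Γ (φ ⟹ ψ)
  | impE {Γ : List Fm} {φ ψ : Fm} : Derives T Γ (φ ⟹ ψ) → Derives T Γ φ → Derives T Γ ψ
  | raa {Γ : List Fm} {φ : Fm} : Derives T (φ.neg :: Γ) Fm.bot → Derives T Γ φ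
  | allI {Γ : List Fm} {φ : Fm} : Derives T (Γ.map Fm.shift) φ → Derives T Γ φ.all
  | allE {Γ : List Fm} {φ : Fm} (t : Tm) : Derives T Γ φ.all → Derives T Γ (φ.inst t)
  | allSI {Γ : List Fm} {φ : Fm} : Derives T (Γ.map Fm.shiftS) φ → Derives T Γ φ.allS
  | allSE {Γ : List Fm} {φ : Fm} (Y : ℕ) : Derives T Γ φ.allS → Derives T Γ (φ.instS Y)
  | eqRefl {Γ : List Fm} (t : Tm) : Derives T Γ (t ≐ t)
  | eqSubst {Γ : List Fm} {s t : Tm} (φ : Fm) :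
      Derives T Γ (s ≐ t) → Derives T Γ (φ.inst s) → Derives T Γ (φ.inst t)

/-- `φ` is provable from the (universal closures of the) axioms in `T`. -/
def Provable (T : Set Fm) (φ : Fm) : Prop := Derives T [] φ

/-! ### The theory `RCA₀*` -/

/-- `Σ⁰₀` formulas of `L₂(exp)`: all quantifiers are number quantifiers `∀ n < t`, `∃ n < t`, where
`n` does not occur in the term `t`.  Set variables may occur free. -/
inductive IsSigma00 : Fm → Prop
  | eq (s t : Tm) : IsSigma00 (s ≐ t)
  | lt (s t : Tm) : IsSigma00 (s ≺ t)
  | mem (t : Tm) (X : ℕ) : IsSigma00 (t ∊ X)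
  | bot : IsSigma00 Fm.bot
  | imp {φ ψ : Fm} : IsSigma00 φ → IsSigma00 ψ → IsSigma00 (φ ⟹ ψ)
  | ball (t : Tm) {φ : Fm} : IsSigma00 φ → IsSigma00 (Fm.all (#0 ≺ t.shift ⟹ φ))
  | bex (t : Tm) {φ : Fm} : IsSigma00 φ → IsSigma00 (Fm.ex (#0 ≺ t.shift ⋏ φ))

/-- The axioms of `RCA₀*`, each standing for its universal closure. -/
inductive RCA0Star : Set Fm
  | succ_ne_zero : RCA0Star (Fm.neg (#0 + 1 ≐ 0))
  | succ_inj : RCA0Star (#0 + 1 ≐ #1 + 1 ⟹ #0 ≐ #1)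
  | add_zero : RCA0Star (#0 + 0 ≐ #0)
  | add_succ : RCA0Star (#0 + (#1 + 1) ≐ (#0 + #1) + 1)
  | mul_zero : RCA0Star (#0 * 0 ≐ 0)
  | mul_succ : RCA0Star (#0 * (#1 + 1) ≐ #0 * #1 + #0)
  | exp_zero : RCA0Star (Tm.exp #0 0 ≐ 1)
  | exp_succ : RCA0Star (Tm.exp #0 (#1 + 1) ≐ Tm.exp #0 #1 * #0)
  | not_lt_zero : RCA0Star (Fm.neg (#0 ≺ 0))
  | lt_succ : RCA0Star (#0 ≺ #1 + 1 ⟺ #0 ≺ #1 ⋎ #0 ≐ #1)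
  /-- `Σ⁰₀` induction: `φ(0) ∧ ∀ n (φ(n) → φ(n + 1)) → ∀ n φ(n)`. -/
  | induction {φ : Fm} : IsSigma00 φ →
      RCA0Star (φ.inst 0 ⋏ Fm.all (φ ⟹ φ.succInst) ⟹ Fm.all φ)
  /-- `Δ⁰₁` comprehension: for a `Σ⁰₁` formula `∃ k θ` and a `Π⁰₁` formula `∀ k η`,
  `∀ n (∃ k θ(n) ↔ ∀ k η(n)) → ∃ X ∀ n (n ∈ X ↔ ∃ k θ(n))`, with `X` not free in `θ`. -/
  | comprehension {θ η : Fm} : IsSigma00 θ → IsSigma00 η →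
      RCA0Star (Fm.all (θ.ex ⟺ η.all) ⟹ Fm.exS (Fm.all (#0 ∊ 0 ⟺ θ.ex.shiftS)))

/-! ### Formulas about sets of natural numbers

The arguments `X`, `Y`, `Z`, `H` are set variables. -/

/-- `X` is bounded: `∃ b ∀ x (x ∈ X → x < b)`. -/
def finite (X : ℕ) : Fm := Fm.ex (Fm.all (#0 ∊ X ⟹ #0 ≺ #1))

/-- `∀ b ∃ x (x ∈ X ∧ b ≤ x)`. -/
def infinite (X : ℕ) : Fm := Fm.all (Fm.ex (#0 ∊ X ⋏ #1 ≼ #0))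

/-- `∀ x (x ∈ X → x ∈ Y)`. -/
def subset (X Y : ℕ) : Fm := Fm.all (#0 ∊ X ⟹ #0 ∊ Y)

/-- `X = Y ∩ Z`: `∀ x (x ∈ X ↔ x ∈ Y ∧ x ∈ Z)`. -/
def isInter (X Y Z : ℕ) : Fm := Fm.all (#0 ∊ X ⟺ #0 ∊ Y ⋏ #0 ∊ Z)

/-- The code `(s + t)² + s` of the pair `(s, t)`. -/
def pair (s t : Tm) : Tm := (s + t) * (s + t) + s

/-- `X` has exactly `t` elements: there is (a set `F` of pairs which is the graph of) a strictly
increasing function from `{i : i < t}` onto `X`.  The five clauses say: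
`∀ p ∈ F, ∃ i x (i < t ∧ x ∈ X ∧ p = (i, x))`; `∀ i < t, ∃ x, (i, x) ∈ F`;
`∀ i x y ((i, x) ∈ F → (i, y) ∈ F → x = y)`; `∀ x ∈ X, ∃ i, (i, x) ∈ F`;
`∀ i j x y ((i, x) ∈ F → (j, y) ∈ F → i < j → x < y)`. -/
def hasCard (X : ℕ) (t : Tm) : Fm :=
  Fm.exS
    (Fm.all (#0 ∊ 0 ⟹
        Fm.ex (Fm.ex (#1 ≺ t.shift.shift.shift ⋏ #0 ∊ (X + 1) ⋏ #2 ≐ pair #1 #0))) ⋏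
      Fm.all (#0 ≺ t.shift ⟹ Fm.ex (pair #1 #0 ∊ 0)) ⋏
      Fm.all (Fm.all (Fm.all (pair #2 #1 ∊ 0 ⟹ pair #2 #0 ∊ 0 ⟹ #1 ≐ #0))) ⋏
      Fm.all (#0 ∊ (X + 1) ⟹ Fm.ex (pair #0 #1 ∊ 0)) ⋏
      Fm.all (Fm.all (Fm.all (Fm.all
        (pair #3 #1 ∊ 0 ⟹ pair #2 #0 ∊ 0 ⟹ #3 ≺ #2 ⟹ #1 ≺ #0)))))

/-- `X` has gaps bounded by `t`: if `x < y` are consecutive elements of `X`, that is, no `z ∈ X`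
satisfies `x < z < y`, then `y ≤ x + t`. -/
def gapsBounded (X : ℕ) (t : Tm) : Fm :=
  Fm.all (Fm.all
    (#1 ∊ X ⟹ #0 ∊ X ⟹ #1 ≺ #0 ⟹ Fm.neg (Fm.ex (#0 ∊ X ⋏ #2 ≺ #0 ⋏ #0 ≺ #1)) ⟹
      #0 ≼ #1 + t.shift.shift))

/-- `X` is infinite and there is `d` such that `X` has gaps bounded by `d`. -/
def syndetic (X : ℕ) : Fm := infinite X ⋏ Fm.ex (gapsBounded X #0)

/-- `X` contains arbitrarily long intervals: `∀ n ∃ a ∀ i < n, a + i ∈ X`. -/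
def thick (X : ℕ) : Fm := Fm.all (Fm.ex (Fm.all (#0 ≺ #2 ⟹ (#1 + #0) ∊ X)))

/-- There is `d` such that for every `n` there is a finite set `H ⊆ X` with at least `n` elements
and gaps bounded by `d`. -/
def piecewiseSyndetic (X : ℕ) : Fm :=
  Fm.ex (Fm.all (Fm.exS
    (finite 0 ⋏ subset 0 (X + 1) ⋏ Fm.ex (#1 ≼ #0 ⋏ hasCard 0 #0) ⋏ gapsBounded 0 #1)))

/-- There are `Y` and `Z` such that `Y` is syndetic, `Z` is thick and `X = Y ∩ Z`. -/
def interSyndeticThick (X : ℕ) : Fm :=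
  Fm.exS (Fm.exS (syndetic 1 ⋏ thick 0 ⋏ isInter (X + 2) 1 0))

end SecondOrderArith

namespace SecondOrderArith

/-! ### Substitution lemmas -/

/-! Provability is reduced to truth: by `provable_of_forall_models`, a Henkin completeness theorem,
it suffices to check the equivalence in an arbitrary model. Inside a model, induction, least
elements and comprehension are used only for predicates defined by Σ⁰₀ formulas with parameters, so
each set formed and each induction must come with a bounded formula.

If X is piecewise syndetic with gap bound d, let Z consist of the z such that X meets [z, z + d],
and let Y be the union of X and the complement of Z. Every window [u, u + d] meets Y, so Y is
syndetic. A finite H ⊆ X with at least n + 1 elements and gaps at most d puts n consecutive numbers,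
starting from the first element of H, into Z (`exists_mem_of_gaps`, `Enumerates.exists_add_le`). As
X ⊆ Z, X = Y ∩ Z.

Conversely, let Y have gaps at most d and let Z contain a long interval. Cut the end of that
interval into n blocks of length d + 1 and keep the first element of Y in each
(`exists_enumerated_subset`). Gaps are then at most 2(d + 1). The i-th element is described directly
from the i-th block, so the enumeration is Σ⁰₀ and needs no counting by recursion. -/

theorem Tm.subst_subst (σ τ : ℕ → Tm) (t : Tm) :
    (t.subst σ).subst τ = t.subst fun i => (σ i).subst τ := by
  induction t <;> simp_all [Tm.subst]

theorem Tm.subst_var (t : Tm) : t.subst Tm.var = t := by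
  induction t <;> simp_all [Tm.subst]

theorem Tm.shift_subst_up (σ : ℕ → Tm) (t : Tm) :
    t.shift.subst (upTm σ) = (t.subst σ).shift := by
  simp [Tm.shift, Tm.subst_subst, Tm.subst, upTm]

theorem upTm_comp (σ τ : ℕ → Tm) :
    (fun i => (upTm σ i).subst (upTm τ)) = upTm fun i => (σ i).subst τ := by
  funext i
  cases i with
  | zero => rfl
  | succ i => exact Tm.shift_subst_up τ (σ i)

theorem upTm_var : upTm Tm.var = Tm.var := by
  funext i; cases i <;> rfl

theorem upSet_comp (ρ π : ℕ → ℕ) :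
    (fun X => upSet π (upSet ρ X)) = upSet fun X => π (ρ X) := by
  funext i; cases i <;> rfl

theorem upSet_id : upSet (fun X => X) = fun X => X := by
  funext i; cases i <;> rfl

namespace Fm

theorem subst_subst (σ τ : ℕ → Tm) (ρ π : ℕ → ℕ) (φ : Fm) :
    (φ.subst σ ρ).subst τ π = φ.subst (fun i => (σ i).subst τ) (fun X => π (ρ X)) := by
  induction φ generalizing σ τ ρ π <;>
    simp_all [Fm.subst, Tm.subst_subst, upTm_comp, upSet_comp]

theorem subst_var (φ : Fm) : φ.subst Tm.var (fun X => X) = φ := by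
  induction φ <;> simp_all [Fm.subst, Tm.subst_var, upTm_var, upSet_id]

theorem shift_subst_up (σ : ℕ → Tm) (ρ : ℕ → ℕ) (φ : Fm) :
    φ.shift.subst (upTm σ) ρ = (φ.subst σ ρ).shift := by
  simp [shift, subst_subst, Tm.subst, upTm, Tm.shift]

theorem shiftS_subst_up (σ : ℕ → Tm) (ρ : ℕ → ℕ) (φ : Fm) :
    φ.shiftS.subst σ (upSet ρ) = (φ.subst σ ρ).shiftS := by
  simp [shiftS, subst_subst, Tm.subst, upSet, Tm.subst_var]

theorem inst_subst (σ : ℕ → Tm) (ρ : ℕ → ℕ) (φ : Fm) (t : Tm) :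
    (φ.inst t).subst σ ρ = (φ.subst (upTm σ) ρ).inst (t.subst σ) := by
  simp only [inst, subst_subst, id]
  congr 1
  funext i
  cases i with
  | zero => rfl
  | succ i => simp [Tm.subst, upTm, Tm.shift, Tm.subst_subst, Tm.subst_var]

theorem instS_subst (σ : ℕ → Tm) (ρ : ℕ → ℕ) (φ : Fm) (Y : ℕ) :
    (φ.instS Y).subst σ ρ = (φ.subst σ (upSet ρ)).instS (ρ Y) := by
  simp only [instS, subst_subst, Tm.subst, Tm.subst_var]
  congr 1
  funext i
  cases i <;> rfl

/-- A formula has only finitely many free variables. -/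
theorem exists_bound (φ : Fm) : ∃ N : ℕ, ∀ (σ σ' : ℕ → Tm) (ρ ρ' : ℕ → ℕ),
    (∀ i < N, σ i = σ' i) → (∀ i < N, ρ i = ρ' i) → φ.subst σ ρ = φ.subst σ' ρ' := by
  have tm (t : Tm) : ∃ N : ℕ, ∀ σ σ' : ℕ → Tm,
      (∀ i < N, σ i = σ' i) → t.subst σ = t.subst σ' := by
    induction t with
    | var i => exact ⟨i + 1, fun σ σ' h => h i (by omega)⟩
    | zero => exact ⟨0, fun _ _ _ => rfl⟩
    | one => exact ⟨0, fun _ _ _ => rfl⟩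
    | add s t hs ht | mul s t hs ht | exp s t hs ht =>
      obtain ⟨m, hm⟩ := hs
      obtain ⟨n, hn⟩ := ht
      refine ⟨max m n, fun σ σ' h => ?_⟩
      simp only [Tm.subst]
      rw [hm σ σ' fun i hi => h i (by omega), hn σ σ' fun i hi => h i (by omega)]
  induction φ with
  | eq s t | lt s t =>
    obtain ⟨m, hm⟩ := tm s
    obtain ⟨n, hn⟩ := tm t
    refine ⟨max m n, fun σ σ' ρ ρ' h _ => ?_⟩
    simp only [subst]
    rw [hm σ σ' fun i hi => h i (by omega), hn σ σ' fun i hi => h i (by omega)]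
  | mem t X =>
    obtain ⟨n, hn⟩ := tm t
    refine ⟨max n (X + 1), fun σ σ' ρ ρ' h h' => ?_⟩
    simp only [subst]
    rw [hn σ σ' fun i hi => h i (by omega), h' X (by omega)]
  | bot => exact ⟨0, fun _ _ _ _ _ _ => rfl⟩
  | imp φ ψ hφ hψ =>
    obtain ⟨m, hm⟩ := hφ
    obtain ⟨n, hn⟩ := hψ
    refine ⟨max m n, fun σ σ' ρ ρ' h h' => ?_⟩
    simp only [subst]
    rw [hm σ σ' ρ ρ' (fun i hi => h i (by omega)) fun i hi => h' i (by omega),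
      hn σ σ' ρ ρ' (fun i hi => h i (by omega)) fun i hi => h' i (by omega)]
  | all φ hφ =>
    obtain ⟨n, hn⟩ := hφ
    refine ⟨n, fun σ σ' ρ ρ' h h' => congrArg all (hn _ _ _ _ (fun i hi => ?_) h')⟩
    cases i with
    | zero => rfl
    | succ i => exact congrArg Tm.shift (h i (by omega))
  | allS φ hφ =>
    obtain ⟨n, hn⟩ := hφ
    refine ⟨n, fun σ σ' ρ ρ' h h' => congrArg allS (hn _ _ _ _ h fun i hi => ?_)⟩
    cases i with
    | zero => rfl
    | succ i => exact congrArg (· + 1) (h' i (by omega))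

theorem exists_bound_list (Γ : List Fm) : ∃ N : ℕ, ∀ φ ∈ Γ, ∀ (σ σ' : ℕ → Tm) (ρ ρ' : ℕ → ℕ),
    (∀ i < N, σ i = σ' i) → (∀ i < N, ρ i = ρ' i) → φ.subst σ ρ = φ.subst σ' ρ' := by
  induction Γ with
  | nil => exact ⟨0, by simp⟩
  | cons ψ Γ ih =>
    obtain ⟨m, hm⟩ := ih
    obtain ⟨n, hn⟩ := exists_bound ψ
    refine ⟨max m n, fun φ hφ σ σ' ρ ρ' h h' => ?_⟩
    rcases List.mem_cons.1 hφ with rfl | hφ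
    · exact hn _ _ _ _ (fun i hi => h i (by omega)) fun i hi => h' i (by omega)
    · exact hm φ hφ _ _ _ _ (fun i hi => h i (by omega)) fun i hi => h' i (by omega)

end Fm

/-! ### Countability of the syntax -/

/-- A numerical code of a term. -/
def Tm.code : Tm → ℕ
  | var i => Nat.pair 0 i
  | zero => Nat.pair 1 0
  | one => Nat.pair 2 0
  | add s t => Nat.pair 3 (Nat.pair s.code t.code)
  | mul s t => Nat.pair 4 (Nat.pair s.code t.code)
  | exp s t => Nat.pair 5 (Nat.pair s.code t.code)

theorem Tm.code_injective : Function.Injective Tm.code := by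
  intro s
  induction s with
  | add s₁ s₂ h₁ h₂ | mul s₁ s₂ h₁ h₂ | exp s₁ s₂ h₁ h₂ =>
    intro t h
    cases t <;> simp [Tm.code, Nat.pair_eq_pair] at h
    rw [h₁ h.1, h₂ h.2]
  | _ =>
    intro t h
    cases t <;> simp_all [Tm.code, Nat.pair_eq_pair]

/-- A numerical code of a formula. -/
def Fm.code : Fm → ℕ
  | eq s t => Nat.pair 0 (Nat.pair s.code t.code)
  | lt s t => Nat.pair 1 (Nat.pair s.code t.code)
  | mem t X => Nat.pair 2 (Nat.pair t.code X)
  | bot => Nat.pair 3 0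
  | imp φ ψ => Nat.pair 4 (Nat.pair φ.code ψ.code)
  | all φ => Nat.pair 5 φ.code
  | allS φ => Nat.pair 6 φ.code

theorem Fm.code_injective : Function.Injective Fm.code := by
  intro φ
  induction φ with
  | imp φ ψ hφ hψ =>
    intro χ h
    cases χ <;> simp [Fm.code, Nat.pair_eq_pair] at h
    rw [hφ h.1, hψ h.2]
  | all φ hφ | allS φ hφ =>
    intro χ h
    cases χ <;> simp [Fm.code, Nat.pair_eq_pair] at h
    rw [hφ h]
  | _ =>
    intro χ h
    cases χ <;> simp_all [Fm.code, Nat.pair_eq_pair, Tm.code_injective.eq_iff]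

instance : Countable Fm := Fm.code_injective.countable

/-! ### Structural properties of derivations -/

namespace Derives

variable {T : Set Fm} {Γ : List Fm} {φ : Fm}

theorem weaken (h : Derives T Γ φ) {Γ' : List Fm} (hΓ : Γ ⊆ Γ') : Derives T Γ' φ := by
  induction h generalizing Γ' with
  | ax σ ρ h => exact ax σ ρ h
  | hyp h => exact hyp (hΓ h)
  | impI _ ih => exact impI (ih (List.cons_subset_cons _ hΓ))
  | impE _ _ ih₁ ih₂ => exact impE (ih₁ hΓ) (ih₂ hΓ)
  | raa _ ih => exact raa (ih (List.cons_subset_cons _ hΓ))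
  | allI _ ih => exact allI (ih (List.map_subset _ hΓ))
  | allE t _ ih => exact allE t (ih hΓ)
  | allSI _ ih => exact allSI (ih (List.map_subset _ hΓ))
  | allSE Y _ ih => exact allSE Y (ih hΓ)
  | eqRefl t => exact eqRefl t
  | eqSubst φ _ _ ih₁ ih₂ => exact eqSubst φ (ih₁ hΓ) (ih₂ hΓ)

theorem subst (h : Derives T Γ φ) (σ : ℕ → Tm) (ρ : ℕ → ℕ) :
    Derives T (Γ.map (Fm.subst σ ρ)) (φ.subst σ ρ) := by
  induction h generalizing σ ρ with
  | ax σ' ρ' h => rw [Fm.subst_subst]; exact ax _ _ h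
  | hyp h => exact hyp (List.mem_map_of_mem h)
  | impI _ ih => exact impI (ih σ ρ)
  | impE _ _ ih₁ ih₂ => exact impE (ih₁ σ ρ) (ih₂ σ ρ)
  | raa _ ih => exact raa (ih σ ρ)
  | allI _ ih =>
    refine allI ?_
    have := ih (upTm σ) ρ
    simpa only [List.map_map, Function.comp_def, Fm.shift_subst_up] using this
  | allE t _ ih => rw [Fm.inst_subst]; exact allE _ (ih σ ρ)
  | allSI _ ih =>
    refine allSI ?_
    have := ih σ (upSet ρ)
    simpa only [List.map_map, Function.comp_def, Fm.shiftS_subst_up] using this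
  | allSE Y _ ih => rw [Fm.instS_subst]; exact allSE _ (ih σ ρ)
  | eqRefl t => exact eqRefl _
  | eqSubst φ _ _ ih₁ ih₂ =>
    rw [Fm.inst_subst]
    refine eqSubst _ (ih₁ σ ρ) ?_
    rw [← Fm.inst_subst]
    exact ih₂ σ ρ

/-- Generalization over a fresh number variable. -/
theorem exists_fresh (T : Set Fm) (Γ : List Fm) (χ : Fm) :
    ∃ v : ℕ, Derives T Γ (χ.inst #v) → Derives T Γ χ.all := by
  obtain ⟨N, hN⟩ := Fm.exists_bound_list (χ :: Γ)
  refine ⟨N, fun h => allI ?_⟩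
  -- This renaming acts as weakening on `Γ` and sends the fresh variable to the one about to be
  -- bound, so it turns `χ.inst #N` back into `χ`.
  let σ : ℕ → Tm := fun i => if i = N then #0 else #(i + 1)
  have key := h.subst σ (fun X => X)
  have hΓ : Γ.map (Fm.subst σ fun X => X) = Γ.map Fm.shift :=
    List.map_congr_left fun φ hφ => hN φ (List.mem_cons_of_mem _ hφ) _ _ _ _
      (fun i hi => by simp [σ, hi.ne]) fun _ _ => rfl
  have hχ : (χ.inst #N).subst σ (fun X => X) = χ := by
    conv_rhs => rw [← χ.subst_var]
    rw [Fm.inst, Fm.subst_subst]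
    refine hN χ List.mem_cons_self _ _ _ _ (fun i hi => ?_) fun _ _ => rfl
    cases i with
    | zero => simp [Tm.subst, σ]
    | succ i => simp [Tm.subst, σ, show i ≠ N by omega]
  rwa [hΓ, hχ] at key

/-- Generalization over a fresh set variable. -/
theorem exists_freshS (T : Set Fm) (Γ : List Fm) (χ : Fm) :
    ∃ Y : ℕ, Derives T Γ (χ.instS Y) → Derives T Γ χ.allS := by
  obtain ⟨N, hN⟩ := Fm.exists_bound_list (χ :: Γ)
  refine ⟨N, fun h => allSI ?_⟩
  let ρ : ℕ → ℕ := fun i => if i = N then 0 else i + 1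
  have key := h.subst Tm.var ρ
  have hΓ : Γ.map (Fm.subst Tm.var ρ) = Γ.map Fm.shiftS :=
    List.map_congr_left fun φ hφ => hN φ (List.mem_cons_of_mem _ hφ) _ _ _ _
      (fun _ _ => rfl) fun i hi => by simp [ρ, hi.ne]
  have hχ : (χ.instS N).subst Tm.var ρ = χ := by
    conv_rhs => rw [← χ.subst_var]
    rw [Fm.instS, Fm.subst_subst]
    refine hN χ List.mem_cons_self _ _ _ _ (fun _ _ => rfl) fun i hi => ?_
    cases i with
    | zero => simp [ρ]
    | succ i => simp [ρ, show i ≠ N by omega]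
  rwa [hΓ, hχ] at key

end Derives

/-! ### Structures and truth -/

/-- Prepend a value to an assignment. -/
def scons {α : Type} (a : α) (e : ℕ → α) : ℕ → α
  | 0 => a
  | i + 1 => e i

@[simp] theorem scons_zero {α : Type} (a : α) (e : ℕ → α) : scons a e 0 = a := rfl

@[simp] theorem scons_succ {α : Type} (a : α) (e : ℕ → α) (i : ℕ) : scons a e (i + 1) = e i := rfl

/-- A two-sorted structure for the language of second-order arithmetic with exponentiation. -/
structure Str where
  /-- The numbers. -/
  N : Type
  /-- The sets. -/
  S : Type
  /-- Zero. -/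
  zero : N
  /-- One. -/
  one : N
  /-- Addition. -/
  add : N → N → N
  /-- Multiplication. -/
  mul : N → N → N
  /-- Exponentiation. -/
  exp : N → N → N
  /-- Order. -/
  lt : N → N → Prop
  /-- Membership. -/
  mem : N → S → Prop

/-- The value of a term. -/
def Tm.eval (M : Str) (e : ℕ → M.N) : Tm → M.N
  | var i => e i
  | zero => M.zero
  | one => M.one
  | add s t => M.add (s.eval M e) (t.eval M e)
  | mul s t => M.mul (s.eval M e) (t.eval M e)
  | exp s t => M.exp (s.eval M e) (t.eval M e)

/-- Truth of a formula under an assignment. -/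
def Fm.sat (M : Str) : (ℕ → M.N) → (ℕ → M.S) → Fm → Prop
  | e, _, eq s t => s.eval M e = t.eval M e
  | e, _, lt s t => M.lt (s.eval M e) (t.eval M e)
  | e, E, mem t X => M.mem (t.eval M e) (E X)
  | _, _, bot => False
  | e, E, imp φ ψ => φ.sat M e E → ψ.sat M e E
  | e, E, all φ => ∀ a, φ.sat M (scons a e) E
  | e, E, allS φ => ∀ A, φ.sat M e (scons A E)

/-- Every formula of `T` is true under every assignment. -/
def Str.Models (M : Str) (T : Set Fm) : Prop :=
  ∀ φ ∈ T, ∀ e E, φ.sat M e E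

/-! ### The completeness theorem -/

section Completeness

variable (T : Set Fm)

/-- The finite consistent lists of formulas, ordered by inclusion. -/
def ConsistentList : Type := {Γ : List Fm // ¬ Derives T Γ Fm.bot}

/-- Larger lists carry more information, so the union over an ideal is a candidate for a complete
theory. -/
instance : Preorder (ConsistentList T) := Preorder.lift fun Γ => {φ | φ ∈ Γ.1}

variable {T}

theorem consistent_cons_of_derives {Γ : List Fm} {φ : Fm} (hΓ : ¬ Derives T Γ Fm.bot)
    (h : Derives T Γ φ) : ¬ Derives T (φ :: Γ) Fm.bot :=
  fun h' => hΓ (.impE (.impI h') h)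

variable (T) in
/-- The consistent lists that decide `ψ`, with a witness in case `ψ` is a refuted universal
formula. -/
def deciding (ψ : Fm) : Order.Cofinal (ConsistentList T) where
  carrier := {Γ | ψ ∈ Γ.1 ∨ ψ.neg ∈ Γ.1 ∧ (∀ χ, ψ = Fm.all χ → ∃ t, (χ.inst t).neg ∈ Γ.1) ∧
    ∀ χ, ψ = Fm.allS χ → ∃ Y, (χ.instS Y).neg ∈ Γ.1}
  isCofinal := by
    rintro ⟨Γ, hΓ⟩
    by_cases hψ : Derives T (ψ :: Γ) Fm.bot
    swap
    · exact ⟨⟨ψ :: Γ, hψ⟩, Or.inl List.mem_cons_self, List.subset_cons_self _ _⟩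
    have hn : ¬ Derives T (ψ.neg :: Γ) Fm.bot := consistent_cons_of_derives hΓ (.impI hψ)
    have refuted : ∀ χ, ¬ Derives T (ψ.neg :: Γ) χ →
        ¬ Derives T (χ.neg :: ψ.neg :: Γ) Fm.bot := fun χ h h' => h (.raa h')
    have hψn : ¬ Derives T (ψ.neg :: Γ) ψ := fun h => hn (.impE (.hyp List.mem_cons_self) h)
    cases ψ with
    | all χ =>
      -- If `χ.inst #v` were derivable for the fresh `v`, then so would be `χ.all`; hence its
      -- negation can be added consistently.
      obtain ⟨v, hv⟩ := Derives.exists_fresh T (χ.all.neg :: Γ) χ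
      refine ⟨⟨_, refuted (χ.inst #v) fun h => hψn (hv h)⟩, Or.inr ⟨by simp, ?_, by simp⟩, ?_⟩
      · rintro _ ⟨⟩
        exact ⟨#v, List.mem_cons_self⟩
      · exact fun _ h => List.mem_cons_of_mem _ (List.mem_cons_of_mem _ h)
    | allS χ =>
      obtain ⟨v, hv⟩ := Derives.exists_freshS T (χ.allS.neg :: Γ) χ
      refine ⟨⟨_, refuted (χ.instS v) fun h => hψn (hv h)⟩, Or.inr ⟨by simp, by simp, ?_⟩, ?_⟩
      · rintro _ ⟨⟩
        exact ⟨v, List.mem_cons_self⟩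
      · exact fun _ h => List.mem_cons_of_mem _ (List.mem_cons_of_mem _ h)
    | _ =>
      exact ⟨⟨_, hn⟩, Or.inr ⟨List.mem_cons_self, by simp, by simp⟩, List.subset_cons_self _ _⟩

/-- A set of formulas that is closed under derivations, complete, and has witnesses. -/
structure IsHenkin (T : Set Fm) (Δ : Set Fm) : Prop where
  closed : ∀ (Γ : List Fm) (φ : Fm), (∀ ψ ∈ Γ, ψ ∈ Δ) → Derives T Γ φ → φ ∈ Δ
  bot_notMem : Fm.bot ∉ Δ
  em : ∀ φ, φ ∈ Δ ∨ φ.neg ∈ Δ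
  witness : ∀ χ : Fm, χ.all ∉ Δ → ∃ t, (χ.inst t).neg ∈ Δ
  witnessS : ∀ χ : Fm, χ.allS ∉ Δ → ∃ Y, (χ.instS Y).neg ∈ Δ

/-- Rasiowa–Sikorski: there are countably many formulas, so some ideal containing `[φ.neg]` meets
every `deciding T ψ`. By directedness, finitely many members of its union lie in one consistent
list. -/
theorem exists_isHenkin {φ : Fm} (h : ¬ Derives T [] φ) : ∃ Δ, IsHenkin T Δ ∧ φ.neg ∈ Δ := by
  have : Encodable Fm := Encodable.ofCountable Fm
  let Γ₀ : ConsistentList T := ⟨[φ.neg], fun h' => h (.raa h')⟩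
  let I := Order.idealOfCofinals Γ₀ (deciding T)
  have hI (ψ : Fm) := Order.cofinal_meets_idealOfCofinals Γ₀ (deciding T) ψ
  let Δ : Set Fm := {ψ | ∃ Γ ∈ I, ψ ∈ Γ.1}
  have hfin (Γ : List Fm) (hΓ : ∀ ψ ∈ Γ, ψ ∈ Δ) : ∃ Γ' ∈ I, Γ ⊆ Γ'.1 := by
    induction Γ with
    | nil => exact ⟨Γ₀, Order.mem_idealOfCofinals _ _, by simp⟩
    | cons ψ Γ ih =>
      obtain ⟨Γ₁, h₁, hs₁⟩ := ih fun χ hχ => hΓ χ (List.mem_cons_of_mem _ hχ)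
      obtain ⟨Γ₂, h₂, hs₂⟩ := hΓ ψ List.mem_cons_self
      obtain ⟨Γ₃, h₃, h13, h23⟩ := I.directed Γ₁ h₁ Γ₂ h₂
      exact ⟨Γ₃, h₃, List.cons_subset.2 ⟨h23 hs₂, fun _ hx => h13 (hs₁ hx)⟩⟩
  have hcon (Γ : List Fm) (hΓ : ∀ ψ ∈ Γ, ψ ∈ Δ) : ¬ Derives T Γ Fm.bot := fun hd => by
    obtain ⟨Γ', -, hs⟩ := hfin Γ hΓ
    exact Γ'.2 (hd.weaken hs)
  have hem (ψ : Fm) : ψ ∈ Δ ∨ ψ.neg ∈ Δ ∧ (∀ χ, ψ = Fm.all χ → ∃ t, (χ.inst t).neg ∈ Δ) ∧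
      ∀ χ, ψ = Fm.allS χ → ∃ Y, (χ.instS Y).neg ∈ Δ := by
    obtain ⟨Γ, hΓ, hΓI⟩ := hI ψ
    rcases hΓ with h | ⟨h, h1, h2⟩
    · exact Or.inl ⟨Γ, hΓI, h⟩
    · exact Or.inr ⟨⟨Γ, hΓI, h⟩, fun χ hχ => (h1 χ hχ).imp fun t ht => ⟨Γ, hΓI, ht⟩,
        fun χ hχ => (h2 χ hχ).imp fun t ht => ⟨Γ, hΓI, ht⟩⟩
  refine ⟨Δ, ⟨fun Γ ψ hΓ hd => ?_, fun hb => ?_, fun ψ => (hem ψ).imp_right And.left, ?_, ?_⟩,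
    Γ₀, Order.mem_idealOfCofinals _ _, by simp [Γ₀]⟩
  · refine (hem ψ).resolve_right fun ⟨hn, _⟩ => hcon (ψ.neg :: Γ) ?_ ?_
    · simpa using ⟨hn, hΓ⟩
    · exact .impE (.hyp List.mem_cons_self) (hd.weaken (List.subset_cons_self _ _))
  · exact hcon [Fm.bot] (by simpa using hb) (.hyp (by simp))
  · exact fun χ hχ => ((hem χ.all).resolve_left hχ).2.1 χ rfl
  · exact fun χ hχ => ((hem χ.allS).resolve_left hχ).2.2 χ rfl

namespace IsHenkin

variable {Δ : Set Fm}

theorem neg_mem (H : IsHenkin T Δ) {φ : Fm} : φ.neg ∈ Δ ↔ φ ∉ Δ :=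
  ⟨fun hn hφ => H.bot_notMem (H.closed [φ.neg, φ] _ (by simp [hn, hφ])
    (.impE (.hyp (by simp : φ.neg ∈ _)) (.hyp (by simp)))), (H.em φ).resolve_left⟩

theorem imp_mem (H : IsHenkin T Δ) {φ ψ : Fm} : (φ ⟹ ψ) ∈ Δ ↔ (φ ∈ Δ → ψ ∈ Δ) := by
  refine ⟨fun h hφ => H.closed [φ ⟹ ψ, φ] _ (by simp [h, hφ])
    (.impE (.hyp (by simp : (φ ⟹ ψ) ∈ _)) (.hyp (by simp))), fun h => ?_⟩
  rcases H.em φ with hφ | hφ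
  · exact H.closed [ψ] _ (by simpa using h hφ) (.impI (.hyp (by simp)))
  · exact H.closed [φ.neg] _ (by simpa using hφ)
      (.impI (.raa (.impE (.hyp (by simp : φ.neg ∈ _)) (.hyp (by simp)))))

theorem all_mem (H : IsHenkin T Δ) {χ : Fm} : χ.all ∈ Δ ↔ ∀ t, χ.inst t ∈ Δ := by
  refine ⟨fun h t => H.closed [χ.all] _ (by simpa using h) (.allE t (.hyp (by simp))), fun h => ?_⟩
  by_contra hn
  obtain ⟨t, ht⟩ := H.witness χ hn
  exact H.neg_mem.1 ht (h t)

theorem allS_mem (H : IsHenkin T Δ) {χ : Fm} : χ.allS ∈ Δ ↔ ∀ Y, χ.instS Y ∈ Δ := by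
  refine ⟨fun h t => H.closed [χ.allS] _ (by simpa using h) (.allSE t (.hyp (by simp))),
    fun h => ?_⟩
  by_contra hn
  obtain ⟨t, ht⟩ := H.witnessS χ hn
  exact H.neg_mem.1 ht (h t)

theorem eq_refl (H : IsHenkin T Δ) (t : Tm) : (t ≐ t) ∈ Δ := H.closed [] _ (by simp) (.eqRefl t)

theorem eq_subst (H : IsHenkin T Δ) {s t : Tm} (χ : Fm) (h : (s ≐ t) ∈ Δ) (hs : χ.inst s ∈ Δ) : χ.inst t ∈ Δ :=
  H.closed [s ≐ t, χ.inst s] _ (by simp [h, hs]) (.eqSubst (s := s) χ (.hyp (by simp)) (.hyp (by simp)))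

theorem eq_symm (H : IsHenkin T Δ) {s t : Tm} (h : (s ≐ t) ∈ Δ) : (t ≐ s) ∈ Δ := by
  have := H.eq_subst (#0 ≐ s.shift) h
  simp only [Fm.inst, Fm.subst, Tm.subst, Tm.shift, Tm.subst_subst, Tm.subst_var] at this
  exact this (H.eq_refl s)

theorem eq_trans (H : IsHenkin T Δ) {s t u : Tm} (h : (s ≐ t) ∈ Δ) (h' : (t ≐ u) ∈ Δ) : (s ≐ u) ∈ Δ := by
  have := H.eq_subst (s.shift ≐ #0) h'
  simp only [Fm.inst, Fm.subst, Tm.subst, Tm.shift, Tm.subst_subst, Tm.subst_var] at this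
  exact this h

/-- Equality in `Δ` is a congruence for every binary operation on terms that commutes with
substitution. -/
theorem eq_congr (H : IsHenkin T Δ) {f : Tm → Tm → Tm}
    (hf : ∀ σ s t, (f s t).subst σ = f (s.subst σ) (t.subst σ)) {s s' t t' : Tm}
    (hs : (s ≐ s') ∈ Δ) (ht : (t ≐ t') ∈ Δ) : (f s t ≐ f s' t') ∈ Δ := by
  have h1 := H.eq_subst ((f s t).shift ≐ f #0 t.shift) hs
  have h2 := H.eq_subst ((f s' t).shift ≐ f s'.shift #0) ht
  simp only [Fm.inst, Fm.subst, Tm.subst, Tm.shift, Tm.subst_subst, Tm.subst_var, hf] at h1 h2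
  exact H.eq_trans (h1 (H.eq_refl _)) (h2 (H.eq_refl _))

/-- Terms up to equality in `Δ`. -/
def setoid (H : IsHenkin T Δ) : Setoid Tm where
  r s t := (s ≐ t) ∈ Δ
  iseqv := ⟨H.eq_refl, H.eq_symm, H.eq_trans⟩

/-- The term model. -/
def str (H : IsHenkin T Δ) : Str where
  N := Quotient H.setoid
  -- Sets are the set variables themselves: with no primitive equality between sets, no quotient is
  -- required.
  S := ℕ
  zero := Quotient.mk _ .zero
  one := Quotient.mk _ .one
  add := Quotient.map₂ .add fun _ _ h _ _ h' => H.eq_congr (fun _ _ _ => rfl) h h'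
  mul := Quotient.map₂ .mul fun _ _ h _ _ h' => H.eq_congr (fun _ _ _ => rfl) h h'
  exp := Quotient.map₂ .exp fun _ _ h _ _ h' => H.eq_congr (fun _ _ _ => rfl) h h'
  lt := Quotient.lift₂ (fun s t => (s ≺ t) ∈ Δ) fun s t s' t' h h' => by
    have aux : ∀ {s t s' t' : Tm}, (s ≐ s') ∈ Δ → (t ≐ t') ∈ Δ → (s ≺ t) ∈ Δ → (s' ≺ t') ∈ Δ := by
      intro s t s' t' hs ht h
      have h1 := H.eq_subst (#0 ≺ t.shift) hs
      have h2 := H.eq_subst (s'.shift ≺ #0) ht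
      simp only [Fm.inst, Fm.subst, Tm.subst, Tm.shift, Tm.subst_subst, Tm.subst_var] at h1 h2
      exact h2 (h1 h)
    exact propext ⟨aux h h', aux (H.eq_symm h) (H.eq_symm h')⟩
  mem := Quotient.lift (fun t X => (t ∊ X) ∈ Δ) fun s t h => by
    have aux : ∀ {s t : Tm} (X : ℕ), (s ≐ t) ∈ Δ → (s ∊ X) ∈ Δ → (t ∊ X) ∈ Δ :=
      fun X h hs => H.eq_subst (#0 ∊ X) h hs
    exact funext fun X => propext ⟨aux X h, aux X (H.eq_symm h)⟩

/-- The element of the term model named by a term. -/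
def cls (H : IsHenkin T Δ) (t : Tm) : H.str.N := Quotient.mk H.setoid t

theorem eval_str (H : IsHenkin T Δ) (σ : ℕ → Tm) (t : Tm) :
    t.eval H.str (fun i => H.cls (σ i)) = H.cls (t.subst σ) := by
  induction t <;> simp_all [Tm.eval, Tm.subst] <;> rfl

/-- The truth lemma. Carrying arbitrary `σ` and `ρ` lets a quantifier step absorb its instance into
the substitution. -/
theorem sat_str (H : IsHenkin T Δ) (σ : ℕ → Tm) (ρ : ℕ → ℕ) (φ : Fm) :
    φ.sat H.str (fun i => H.cls (σ i)) ρ ↔ φ.subst σ ρ ∈ Δ := by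
  induction φ generalizing σ ρ with
  | eq s t => simp only [Fm.sat, eval_str, Fm.subst]; exact Quotient.eq (r := H.setoid)
  | lt s t => simp only [Fm.sat, eval_str]; rfl
  | mem t X => simp only [Fm.sat, eval_str]; rfl
  | bot => exact iff_of_false id H.bot_notMem
  | imp φ ψ hφ hψ => simp only [Fm.sat, hφ, hψ, Fm.subst, H.imp_mem]
  | all φ ih =>
    simp only [Fm.sat, Fm.subst, H.all_mem]
    have key (t : Tm) : φ.sat H.str (scons (H.cls t) fun i => H.cls (σ i)) ρ ↔
        (φ.subst (upTm σ) ρ).inst t ∈ Δ := by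
      have hs : (scons (H.cls t) fun i => H.cls (σ i) : ℕ → H.str.N) =
          fun i => H.cls (scons t σ i) := by
        funext i; cases i <;> rfl
      have hi : (φ.subst (upTm σ) ρ).inst t = φ.subst (scons t σ) ρ := by
        rw [Fm.inst, Fm.subst_subst]
        refine congrArg (fun τ => φ.subst τ ρ) (funext fun i => ?_)
        cases i with
        | zero => rfl
        | succ i => simp [upTm, Tm.shift, Tm.subst_subst, Tm.subst, Tm.subst_var]
      rw [hs, ih, hi]
    exact ⟨fun h t => (key t).1 (h _), fun h a => Quotient.inductionOn a fun t => (key t).2 (h t)⟩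
  | allS φ ih =>
    simp only [Fm.sat, Fm.subst, H.allS_mem]
    refine forall_congr' fun (Y : ℕ) => ?_
    have hi : (φ.subst σ (upSet ρ)).instS Y = φ.subst σ (scons Y ρ) := by
      rw [Fm.instS, Fm.subst_subst]
      simp only [Tm.subst_var]
      refine congrArg (fun π => φ.subst σ π) (funext fun i => ?_)
      cases i <;> rfl
    rw [hi]
    exact ih σ (scons Y ρ)

theorem models_str (H : IsHenkin T Δ) : H.str.Models T := by
  intro φ hφ e E
  obtain ⟨σ, rfl⟩ : ∃ σ : ℕ → Tm, e = fun i => H.cls (σ i) :=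
    ⟨fun i => Quotient.out (s := H.setoid) (e i), funext fun i => (Quotient.out_eq (e i)).symm⟩
  refine (H.sat_str σ E φ).2 ?_
  exact H.closed [] _ (by simp) (.ax σ E hφ)

end IsHenkin

/-- Gödel's completeness theorem for the two-sorted calculus. -/
theorem provable_of_forall_models {φ : Fm}
    (h : ∀ M : Str, M.Models T → ∀ e E, φ.sat M e E) : Provable T φ := by
  by_contra hn
  obtain ⟨Δ, H, hφ⟩ := exists_isHenkin hn
  refine H.neg_mem.1 hφ ?_
  rw [← φ.subst_var, ← H.sat_str]
  exact h _ H.models_str _ _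

end Completeness

/-! ### Truth of defined connectives and of substitution instances -/

section Truth

variable {M : Str} {e : ℕ → M.N} {E : ℕ → M.S} {φ ψ : Fm}

theorem Tm.eval_subst (σ : ℕ → Tm) (t : Tm) :
    (t.subst σ).eval M e = t.eval M fun i => (σ i).eval M e := by
  induction t <;> simp_all [Tm.subst, Tm.eval]

@[simp] theorem Tm.eval_shift (a : M.N) (t : Tm) : t.shift.eval M (scons a e) = t.eval M e := by
  simp [Tm.shift, Tm.eval_subst, Tm.eval]

namespace Fm

theorem sat_subst (σ : ℕ → Tm) (ρ : ℕ → ℕ) (φ : Fm) (e : ℕ → M.N) (E : ℕ → M.S) :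
    (φ.subst σ ρ).sat M e E ↔ φ.sat M (fun i => (σ i).eval M e) fun X => E (ρ X) := by
  induction φ generalizing σ ρ e E with
  | eq s t => simp [subst, sat, Tm.eval_subst]
  | lt s t => simp [subst, sat, Tm.eval_subst]
  | mem t X => simp [subst, sat, Tm.eval_subst]
  | bot => rfl
  | imp φ ψ hφ hψ => simp [subst, sat, hφ, hψ]
  | all φ ih =>
    simp only [subst, sat, ih]
    refine forall_congr' fun a => iff_of_eq (congrArg (fun e' => φ.sat M e' _) (funext fun i => ?_))
    cases i with
    | zero => rfl
    | succ i => simp [upTm]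
  | allS φ ih =>
    simp only [subst, sat, ih]
    refine forall_congr' fun A => iff_of_eq (congrArg (fun E' => φ.sat M _ E') (funext fun i => ?_))
    cases i <;> rfl

@[simp] theorem sat_mem {t : Tm} {X : ℕ} : (t ∊ X).sat M e E ↔ M.mem (t.eval M e) (E X) := Iff.rfl

@[simp] theorem sat_eq {s t : Tm} : (s ≐ t).sat M e E ↔ s.eval M e = t.eval M e := Iff.rfl

@[simp] theorem sat_bot : ¬ bot.sat M e E := id

@[simp] theorem sat_imp : (φ ⟹ ψ).sat M e E ↔ (φ.sat M e E → ψ.sat M e E) := Iff.rfl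

@[simp] theorem sat_all : φ.all.sat M e E ↔ ∀ a, φ.sat M (scons a e) E := Iff.rfl

@[simp] theorem sat_allS : φ.allS.sat M e E ↔ ∀ A, φ.sat M e (scons A E) := Iff.rfl

@[simp] theorem sat_neg : φ.neg.sat M e E ↔ ¬ φ.sat M e E := Iff.rfl

@[simp] theorem sat_and : (φ ⋏ ψ).sat M e E ↔ φ.sat M e E ∧ ψ.sat M e E := by
  simp [Fm.and]

@[simp] theorem sat_or : (φ ⋎ ψ).sat M e E ↔ φ.sat M e E ∨ ψ.sat M e E := by
  simp [Fm.or, or_iff_not_imp_left]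

@[simp] theorem sat_iff : (φ ⟺ ψ).sat M e E ↔ (φ.sat M e E ↔ ψ.sat M e E) := by
  simp [Fm.iff, iff_def]

@[simp] theorem sat_ex : φ.ex.sat M e E ↔ ∃ a, φ.sat M (scons a e) E := by
  simp [Fm.ex]

@[simp] theorem sat_exS : φ.exS.sat M e E ↔ ∃ A, φ.sat M e (scons A E) := by
  simp [Fm.exS]

theorem sat_inst (t : Tm) : (φ.inst t).sat M e E ↔ φ.sat M (scons (t.eval M e) e) E := by
  rw [inst, sat_subst]
  refine iff_of_eq (congrArg (fun e' => φ.sat M e' _) (funext fun i => ?_))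
  cases i <;> rfl

theorem sat_shift (a : M.N) : φ.shift.sat M (scons a e) E ↔ φ.sat M e E := by
  rw [shift, sat_subst]; rfl

theorem sat_shiftS (A : M.S) : φ.shiftS.sat M e (scons A E) ↔ φ.sat M e E := by
  rw [shiftS, sat_subst]; rfl

theorem sat_succInst (a : M.N) :
    φ.succInst.sat M (scons a e) E ↔ φ.sat M (scons (M.add a M.one) e) E := by
  rw [succInst, sat_subst]
  refine iff_of_eq (congrArg (fun e' => φ.sat M e' _) (funext fun i => ?_))
  cases i <;> rfl

/-- The bounded quantifier `∀ n < t`. -/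
def ball (t : Tm) (φ : Fm) : Fm := all (#0 ≺ t.shift ⟹ φ)

/-- The bounded quantifier `∃ n < t`. -/
def bex (t : Tm) (φ : Fm) : Fm := ex (#0 ≺ t.shift ⋏ φ)

end Fm
end Truth

/-! ### Closure properties of `Σ⁰₀` formulas -/

namespace IsSigma00

variable {φ ψ : Fm}

theorem neg (h : IsSigma00 φ) : IsSigma00 φ.neg := h.imp .bot

theorem and (h : IsSigma00 φ) (h' : IsSigma00 ψ) : IsSigma00 (φ ⋏ ψ) := (h.imp h'.neg).neg

theorem or (h : IsSigma00 φ) (h' : IsSigma00 ψ) : IsSigma00 (φ ⋎ ψ) := h.neg.imp h'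

theorem le (s t : Tm) : IsSigma00 (s ≼ t) := (IsSigma00.lt s t).or (.eq s t)

/-- Needed to weaken a Σ⁰₀ formula by a dummy variable in `RCAModel.comprehension`. -/
theorem subst (h : IsSigma00 φ) (σ : ℕ → Tm) (ρ : ℕ → ℕ) : IsSigma00 (φ.subst σ ρ) := by
  induction h generalizing σ ρ with
  | eq s t => exact .eq _ _
  | lt s t => exact .lt _ _
  | mem t X => exact .mem _ _
  | bot => exact .bot
  | imp _ _ h₁ h₂ => exact .imp (h₁ σ ρ) (h₂ σ ρ)
  | ball t _ ih =>
    have := IsSigma00.ball (t.subst σ) (ih (upTm σ) ρ)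
    rwa [← Tm.shift_subst_up] at this
  | bex t _ ih =>
    have := IsSigma00.bex (t.subst σ) (ih (upTm σ) ρ)
    rwa [← Tm.shift_subst_up] at this

end IsSigma00

attribute [simp] IsSigma00.eq IsSigma00.lt IsSigma00.mem IsSigma00.bot IsSigma00.imp
  IsSigma00.neg IsSigma00.and IsSigma00.or IsSigma00.le

@[simp] theorem Fm.isSigma00_ball {t : Tm} {φ : Fm} (h : IsSigma00 φ) : IsSigma00 (Fm.ball t φ) :=
  .ball t h

@[simp] theorem Fm.isSigma00_bex {t : Tm} {φ : Fm} (h : IsSigma00 φ) : IsSigma00 (Fm.bex t φ) :=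
  .bex t h

/-! ### Models of `RCA₀*` -/

/-- A model of `RCA₀*`. -/
structure RCAModel extends Str where
  models : toStr.Models RCA0Star
  -- Truth is relative to an assignment of sets, so even axioms without set variables can be used
  -- only if some set exists.
  nonempty : Nonempty S

namespace RCAModel

variable {M : RCAModel}

instance : Nonempty M.S := M.nonempty
instance : Zero M.N := ⟨M.zero⟩
instance : One M.N := ⟨M.one⟩
instance : Add M.N := ⟨M.add⟩
instance : Mul M.N := ⟨M.mul⟩
instance : LT M.N := ⟨M.lt⟩
-- This is the interpretation of `≼`, which keeps formulas and the model order in step.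
instance : LE M.N := ⟨fun a b => a < b ∨ a = b⟩

variable {e : ℕ → M.N} {E : ℕ → M.S}

@[simp] theorem eval_var (i : ℕ) : Tm.eval M.toStr e #i = e i := rfl
@[simp] theorem eval_zero : Tm.eval M.toStr e 0 = 0 := rfl
@[simp] theorem eval_one : Tm.eval M.toStr e 1 = 1 := rfl
@[simp] theorem eval_add (s t : Tm) :
    Tm.eval M.toStr e (s + t) = s.eval M.toStr e + t.eval M.toStr e := rfl
@[simp] theorem eval_mul (s t : Tm) :
    Tm.eval M.toStr e (s * t) = s.eval M.toStr e * t.eval M.toStr e := rfl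

@[simp] theorem sat_lt {s t : Tm} :
    (s ≺ t).sat M.toStr e E ↔ s.eval M.toStr e < t.eval M.toStr e := Iff.rfl

@[simp] theorem sat_le {s t : Tm} :
    (s ≼ t).sat M.toStr e E ↔ s.eval M.toStr e ≤ t.eval M.toStr e := by
  simp [Fm.le]; rfl

@[simp] theorem sat_ball {t : Tm} {φ : Fm} : (Fm.ball t φ).sat M.toStr e E ↔
    ∀ a < t.eval M.toStr e, φ.sat M.toStr (scons a e) E := by
  simp [Fm.ball]

@[simp] theorem sat_bex {t : Tm} {φ : Fm} : (Fm.bex t φ).sat M.toStr e E ↔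
    ∃ a < t.eval M.toStr e, φ.sat M.toStr (scons a e) E := by
  simp [Fm.bex]

/-- `P` is defined by a `Σ⁰₀` formula with parameters. -/
def Definable (P : M.N → Prop) : Prop :=
  ∃ φ e E, IsSigma00 φ ∧ ∀ x, P x ↔ φ.sat M.toStr (scons x e) E

theorem Definable.of_formula {P : M.N → Prop} (φ : Fm) (e : ℕ → M.N) (E : ℕ → M.S)
    (hφ : IsSigma00 φ) (h : ∀ x, P x ↔ φ.sat M.toStr (scons x e) E) : Definable P :=
  ⟨φ, e, E, hφ, h⟩

/-- A `Σ⁰₀` formula without set parameters. -/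
theorem Definable.of_formula₀ {P : M.N → Prop} (φ : Fm) (e : ℕ → M.N)
    (hφ : IsSigma00 φ) (h : ∀ E x, P x ↔ φ.sat M.toStr (scons x e) E) : Definable P :=
  ⟨φ, e, fun _ => Classical.arbitrary _, hφ, h _⟩

theorem induction {P : M.N → Prop} (hP : Definable P) (h0 : P 0) (hs : ∀ n, P n → P (n + 1))
    (n : M.N) : P n := by
  obtain ⟨φ, e, E, hφ, h⟩ := hP
  have := M.models _ (.induction hφ) e E
  simp only [Fm.sat_imp, Fm.sat_and, Fm.sat_all, Fm.sat_inst, Fm.sat_succInst] at this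
  rw [h]
  refine this ⟨(h 0).1 h0, fun a ha => (h (a + 1)).1 (hs a ((h a).2 ha))⟩ n

theorem comprehension {P : M.N → Prop} (hP : Definable P) : ∃ X : M.S, ∀ n, M.mem n X ↔ P n := by
  obtain ⟨φ, e, E, hφ, h⟩ := hP
  -- With a dummy quantified variable, `φ` serves as both the Σ⁰₁ and the Π⁰₁ formula.
  have := M.models _ (.comprehension (hφ.subst (fun i => #(i + 1)) id)
    (hφ.subst (fun i => #(i + 1)) id)) e E
  simp only [Fm.sat_imp, Fm.sat_iff, Fm.sat_exS, Fm.sat_all, Fm.sat_ex, Fm.sat_shiftS,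
    Fm.sat_mem, ← Fm.shift.eq_def, Fm.sat_shift] at this
  obtain ⟨X, hX⟩ := this fun a => ⟨fun ⟨_, h⟩ _ => h, fun h => ⟨a, h a⟩⟩
  exact ⟨X, fun n => (hX n).trans ⟨fun ⟨_, h'⟩ => (h n).2 h', fun h' => ⟨n, (h n).1 h'⟩⟩⟩

/-! ### Arithmetic in a model -/

section Basic

variable (a b c : M.N)

/-- Truth of an axiom under an assignment with at most two relevant values. -/
theorem sat_axiom {φ : Fm} (hφ : φ ∈ RCA0Star) :
    φ.sat M.toStr (scons a fun _ => b) fun _ => Classical.arbitrary _ :=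
  M.models _ hφ _ _

theorem add_zero' : a + 0 = a := by simpa using sat_axiom a a .add_zero

theorem add_succ : a + (b + 1) = a + b + 1 := by simpa using sat_axiom a b .add_succ

theorem mul_zero' : a * 0 = 0 := by simpa using sat_axiom a a .mul_zero

theorem mul_succ : a * (b + 1) = a * b + a := by simpa using sat_axiom a b .mul_succ

theorem not_lt_zero' : ¬ a < 0 := by simpa using sat_axiom a a .not_lt_zero

theorem lt_succ : a < b + 1 ↔ a < b ∨ a = b := by simpa using sat_axiom a b .lt_succ

/-- As in the inductions below, the defining formula is supplied explicitly: variable 0 is the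
induction variable and the parameters start at variable 1. -/
theorem zero_add' : 0 + a = a :=
  induction (P := fun x => 0 + x = x)
    (.of_formula₀ (0 + #0 ≐ #0) (fun _ => a) (by simp) (by simp)) (add_zero' 0)
    (fun n h => by rw [add_succ, h]) a

theorem succ_add : a + 1 + b = a + b + 1 :=
  induction (P := fun x => a + 1 + x = a + x + 1)
    (.of_formula₀ (#1 + 1 + #0 ≐ #1 + #0 + 1) (fun _ => a) (by simp) (by simp))
    (by simp only [add_zero']) (fun n h => by simp only [add_succ, h]) b

theorem add_comm' : a + b = b + a :=
  induction (P := fun x => a + x = x + a)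
    (.of_formula₀ (#1 + #0 ≐ #0 + #1) (fun _ => a) (by simp) (by simp))
    (by rw [add_zero', zero_add']) (fun n h => by rw [add_succ, h, succ_add]) b

theorem add_assoc' : a + b + c = a + (b + c) :=
  induction (P := fun x => a + b + x = a + (b + x))
    (.of_formula₀ (#1 + #2 + #0 ≐ #1 + (#2 + #0)) (scons a fun _ => b) (by simp) (by simp))
    (by simp only [add_zero']) (fun n h => by simp only [add_succ, h]) c

instance : AddCommMonoid M.N where
  add_assoc := add_assoc'
  zero_add := zero_add'
  add_zero := add_zero'
  add_comm := add_comm'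
  nsmul := nsmulRec

theorem zero_mul' : 0 * a = 0 :=
  induction (P := fun x => 0 * x = 0)
    (.of_formula₀ (0 * #0 ≐ 0) (fun _ => a) (by simp) (by simp)) (mul_zero' 0)
    (fun n h => by rw [mul_succ, h, add_zero]) a

theorem succ_mul : (a + 1) * b = a * b + b :=
  induction (P := fun x => (a + 1) * x = a * x + x)
    (.of_formula₀ ((#1 + 1) * #0 ≐ #1 * #0 + #0) (fun _ => a) (by simp) (by simp))
    (by simp only [mul_zero', add_zero])
    (fun n h => by simp only [mul_succ, h]; ac_rfl) b

theorem mul_comm' : a * b = b * a :=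
  induction (P := fun x => a * x = x * a)
    (.of_formula₀ (#1 * #0 ≐ #0 * #1) (fun _ => a) (by simp) (by simp))
    (by rw [mul_zero', zero_mul']) (fun n h => by rw [mul_succ, h, succ_mul]) b

theorem mul_add' : a * (b + c) = a * b + a * c :=
  induction (P := fun x => a * (b + x) = a * b + a * x)
    (.of_formula₀ (#1 * (#2 + #0) ≐ #1 * #2 + #1 * #0) (scons a fun _ => b) (by simp) (by simp))
    (by simp only [mul_zero', add_zero])
    (fun n h => by rw [← add_assoc, mul_succ, h, mul_succ, add_assoc]) c

theorem mul_assoc' : a * b * c = a * (b * c) :=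
  induction (P := fun x => a * b * x = a * (b * x))
    (.of_formula₀ (#1 * #2 * #0 ≐ #1 * (#2 * #0)) (scons a fun _ => b) (by simp) (by simp))
    (by simp only [mul_zero']) (fun n h => by rw [mul_succ, h, mul_succ, mul_add']) c

theorem mul_one' : a * 1 = a := by
  rw [← zero_add' 1, mul_succ, mul_zero', zero_add]

instance : CommSemiring M.N where
  mul_assoc := mul_assoc'
  one_mul a := by rw [mul_comm', mul_one']
  mul_one := mul_one'
  zero_mul := zero_mul'
  mul_zero := mul_zero'
  mul_comm := mul_comm'
  left_distrib := mul_add'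
  right_distrib a b c := by rw [mul_comm', mul_add', mul_comm' c, mul_comm' c]

/-! ### The order and its compatibility with addition and multiplication. -/

theorem lt_succ_self : a < a + 1 := (lt_succ a a).2 (Or.inr rfl)

variable {a b c}

theorem lt_trans' (hab : a < b) (hbc : b < c) : a < c := by
  refine induction (P := fun x => b < x → a < x)
    (.of_formula₀ (#2 ≺ #0 ⟹ #1 ≺ #0) (scons a fun _ => b) (by simp) (by simp))
    (fun h => (not_lt_zero' _ h).elim) (fun n h h' => ?_) c hbc
  rcases (lt_succ b n).1 h' with h' | rfl
  · exact (lt_succ a n).2 (Or.inl (h h'))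
  · exact (lt_succ a b).2 (Or.inl hab)

theorem lt_irrefl' (a : M.N) : ¬ a < a := by
  refine induction (P := fun x => ¬ x < x)
    (.of_formula₀ (Fm.neg (#0 ≺ #0)) (fun _ => a) (by simp) (by simp)) (not_lt_zero' 0)
    (fun n h h' => ?_) a
  rcases (lt_succ _ _).1 h' with h' | h'
  · exact h (lt_trans' (lt_succ_self n) h')
  · have := lt_succ_self n
    rw [h'] at this
    exact h this

theorem succ_lt_succ (h : a < b) : a + 1 < b + 1 := by
  refine induction (P := fun x => a < x → a + 1 < x + 1)
    (.of_formula₀ (#1 ≺ #0 ⟹ #1 + 1 ≺ #0 + 1) (fun _ => a) (by simp) (by simp))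
    (fun h => (not_lt_zero' _ h).elim) (fun n h h' => ?_) b h
  rcases (lt_succ _ _).1 h' with h' | rfl
  · exact lt_trans' (h h') (lt_succ_self _)
  · exact lt_succ_self _

theorem zero_le' (a : M.N) : 0 ≤ a := by
  refine induction (P := fun x => 0 ≤ x)
    (.of_formula₀ (0 ≼ #0) (fun _ => a) (by simp) (by simp)) (Or.inr rfl)
    (fun n h => Or.inl ((lt_succ _ _).2 h)) a

theorem lt_trichotomy' (a b : M.N) : a < b ∨ a = b ∨ b < a := by
  refine induction (P := fun x => x < b ∨ x = b ∨ b < x)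
    (.of_formula₀ (#0 ≺ #1 ⋎ #0 ≐ #1 ⋎ #1 ≺ #0) (fun _ => b) (by simp) (by simp))
    ((zero_le' b).imp_right Or.inl) (fun n h => ?_) a
  rcases h with h | rfl | h
  · exact ((lt_succ _ _).1 (succ_lt_succ h)).imp_right Or.inl
  · exact Or.inr (Or.inr (lt_succ_self _))
  · exact Or.inr (Or.inr (lt_trans' h (lt_succ_self _)))

noncomputable instance : LinearOrder M.N where
  le_refl a := Or.inr rfl
  le_trans a b c := by
    rintro (h | rfl) (h' | rfl)
    · exact Or.inl (lt_trans' h h')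
    · exact Or.inl h
    · exact Or.inl h'
    · exact Or.inr rfl
  le_antisymm a b := by
    rintro (h | rfl) (h' | h')
    · exact (lt_irrefl' _ (lt_trans' h h')).elim
    · exact h'.symm
    · rfl
    · rfl
  lt_iff_le_not_ge a b := by
    constructor
    · intro h
      refine ⟨Or.inl h, ?_⟩
      rintro (h' | rfl)
      · exact lt_irrefl' _ (lt_trans' h h')
      · exact lt_irrefl' _ h
    · rintro ⟨h | rfl, h'⟩
      · exact h
      · exact (h' (Or.inr rfl)).elim
  le_total a b := by
    rcases lt_trichotomy' a b with h | rfl | h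
    · exact Or.inl (Or.inl h)
    · exact Or.inl (Or.inr rfl)
    · exact Or.inr (Or.inl h)
  toDecidableLE := Classical.decRel _

theorem lt_add_one_iff' : a < b + 1 ↔ a ≤ b := lt_succ a b

theorem add_lt_add_right' (h : a < b) (c : M.N) : a + c < b + c := by
  refine induction (P := fun x => a + x < b + x)
    (.of_formula₀ (#1 + #0 ≺ #2 + #0) (scons a fun _ => b) (by simp) (by simp))
    (by simpa only [add_zero] using h) (fun n h => ?_) c
  simpa only [add_succ] using succ_lt_succ h

theorem mul_lt_mul_right'' (h : a < b) (hc : 0 < c) : a * c < b * c := by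
  have key : ∀ x : M.N, a * (x + 1) < b * (x + 1) := by
    refine induction
      (.of_formula₀ (#1 * (#0 + 1) ≺ #2 * (#0 + 1)) (scons a fun _ => b) (by simp) (by simp))
      (by simpa using h) (fun n h' => ?_)
    rw [mul_succ a, mul_succ b]
    refine lt_trans' (add_lt_add_right' h' _) ?_
    rw [add_comm _ a, add_comm _ b]
    exact add_lt_add_right' h _
  -- The bound `y < x` keeps the existence of a predecessor Σ⁰₀.
  have : ∀ x : M.N, 0 < x → ∃ y < x, x = y + 1 := by
    refine induction
      (.of_formula₀ (0 ≺ #0 ⟹ Fm.bex #0 (#1 ≐ #0 + 1)) (fun _ => 0) (by simp) (by simp))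
      (fun h => (lt_irrefl' _ h).elim) (fun n _ _ => ⟨n, lt_succ_self n, rfl⟩)
  obtain ⟨y, -, rfl⟩ := this c hc
  exact key y

instance : IsOrderedCancelAddMonoid M.N :=
  IsOrderedCancelAddMonoid.of_add_lt_add_left fun a b c h => by
    rw [add_comm a, add_comm a]; exact add_lt_add_right' h a

instance : IsStrictOrderedRing M.N where
  zero_le_one := zero_le' 1
  exists_pair_ne := ⟨0, 1, fun h => lt_irrefl' (0 : M.N) (by
    have := lt_succ_self (0 : M.N); rwa [zero_add, ← h] at this)⟩
  mul_lt_mul_of_pos_left a ha b c h := by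
    rw [mul_comm a, mul_comm a]; exact mul_lt_mul_right'' h ha
  mul_lt_mul_of_pos_right a ha b c h := mul_lt_mul_right'' h ha

end Basic

theorem add_one_le_iff {a b : M.N} : a + 1 ≤ b ↔ a < b := by
  rw [← lt_add_one_iff']
  exact ⟨lt_of_add_lt_add_right, succ_lt_succ⟩

theorem exists_add_of_le' {a b : M.N} (h : a ≤ b) : ∃ c, b = a + c := by
  have key : ∀ x, a ≤ x → ∃ c < x + 1, x = a + c := by
    refine induction (.of_formula₀ (#1 ≼ #0 ⟹ Fm.bex (#0 + 1) (#1 ≐ #2 + #0)) (fun _ => a)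
      (by simp) (by simp)) (fun h => ⟨0, lt_succ_self 0, ?_⟩) (fun n h h' => ?_)
    · rw [add_zero]
      exact le_antisymm (zero_le' a) h
    · rcases h'.lt_or_eq with h' | rfl
      · obtain ⟨c, hc, rfl⟩ := h (lt_add_one_iff'.1 h')
        exact ⟨c + 1, succ_lt_succ hc, (add_succ a c).symm⟩
      · exact ⟨0, lt_add_one_iff'.2 (zero_le' _), (add_zero _).symm⟩
  obtain ⟨c, -, hc⟩ := key b h
  exact ⟨c, hc⟩

/-- The least number principle for `Σ⁰₀` predicates. -/
theorem exists_least {P : M.N → Prop} (hP : Definable P) {n : M.N} (hn : P n) :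
    ∃ m ≤ n, P m ∧ ∀ k < m, ¬ P k := by
  by_contra! h
  obtain ⟨X, hX⟩ := comprehension hP
  -- Without a least element, induction on `x` empties every initial segment of `X`, contradicting
  -- `hn`.
  have key : ∀ x, ∀ k < x, ¬ M.mem k X := by
    refine induction (.of_formula (Fm.ball #0 (#0 ∊ 0).neg) (fun _ => 0) (fun _ => X)
      (by simp) (by simp)) (fun k hk => (not_lt_zero' k hk).elim) (fun x hx k hk => ?_)
    rcases (lt_succ _ _).1 hk with hk | rfl
    · exact hx k hk
    · intro hk
      rcases le_or_gt k n with hkn | hkn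
      · obtain ⟨j, hj, hj'⟩ := h k hkn ((hX k).1 hk)
        exact hx j hj ((hX j).2 hj')
      · exact hx n hkn ((hX n).2 hn)
  exact key (n + 1) n (lt_succ_self n) ((hX n).2 hn)

/-- The value of the pairing term. -/
def code (i x : M.N) : M.N := (i + x) * (i + x) + i

@[simp] theorem eval_pair {e : ℕ → M.N} (s t : Tm) :
    (pair s t).eval M.toStr e = code (s.eval M.toStr e) (t.eval M.toStr e) := rfl

/-- With s = i + x, the code lies in [s², (s + 1)²) because i ≤ s. These intervals are disjoint for
distinct s, so the code determines s, then i, then x. -/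
theorem code_inj {i x j y : M.N} (h : code i x = code j y) : i = j ∧ x = y := by
  have aux : ∀ {i x j y : M.N}, i + x < j + y → code i x < code j y := by
    intro i x j y h
    have h1 : (i + x + 1) * (i + x + 1) ≤ (j + y) * (j + y) :=
      mul_le_mul (add_one_le_iff.2 h) (add_one_le_iff.2 h) (zero_le' _) (zero_le' _)
    calc code i x < (i + x + 1) * (i + x + 1) := by
          have e1 : (i + x + 1) * (i + x + 1) = code i x + (i + x + x + 1) := by
            unfold code; ring
          rw [e1]
          exact lt_add_of_pos_right _ ((zero_le' _).trans_lt (lt_succ_self _))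
      _ ≤ (j + y) * (j + y) := h1
      _ ≤ code j y := le_add_of_nonneg_right (zero_le' _)
  have hs : i + x = j + y := by
    rcases lt_trichotomy (i + x) (j + y) with h' | h' | h'
    · exact ((aux h').ne h).elim
    · exact h'
    · exact ((aux h').ne' h).elim
  unfold code at h
  rw [hs] at h
  obtain rfl := add_left_cancel h
  exact ⟨rfl, add_left_cancel hs⟩

/-! ### Gaps -/

/-- In a set with gaps bounded by `d`, every number lying between two elements is followed by an
element at distance at most `d`. -/
theorem exists_mem_of_gaps {A : M.S} {d : M.N}
    (hA : ∀ x y, M.mem x A → M.mem y A → x < y → (¬ ∃ z, M.mem z A ∧ x < z ∧ z < y) → y ≤ x + d)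
    {u x₀ y₀ : M.N} (hx₀ : M.mem x₀ A) (hxu : x₀ ≤ u) (hy₀ : M.mem y₀ A) (huy : u < y₀) :
    ∃ y, M.mem y A ∧ u < y ∧ y ≤ u + d := by
  obtain ⟨y, -, ⟨hyA, huy'⟩, hy⟩ := exists_least (P := fun y => M.mem y A ∧ u < y)
    (.of_formula (#0 ∊ 0 ⋏ #1 ≺ #0) (fun _ => u) (fun _ => A) (by simp) (by simp)) ⟨hy₀, huy⟩
  -- The last element of `A` up to `u` is the predecessor of the least strict upper bound `w` of `A`
  -- ∩ [0, u]. It and `y` are consecutive in `A`.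
  obtain ⟨w, hwu, hw, hw'⟩ := exists_least (P := fun w => ∀ z < u + 1, M.mem z A → z < w)
    (.of_formula (Fm.ball (#1 + 1) (#0 ∊ 0 ⟹ #0 ≺ #1)) (fun _ => u) (fun _ => A)
      (by simp) (by simp)) (n := u + 1) (fun z hz _ => hz)
  have hw0 : 1 ≤ w := by
    have := add_one_le_iff.2 ((zero_le' _).trans_lt (hw x₀ (lt_add_one_iff'.2 hxu) hx₀))
    rwa [zero_add] at this
  obtain ⟨x, rfl⟩ := exists_add_of_le' hw0
  rw [add_comm 1 x] at hwu hw hw'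
  obtain ⟨z, hzu, hzA, hxz⟩ : ∃ z < u + 1, M.mem z A ∧ x ≤ z := by
    simpa using hw' x (lt_succ_self x)
  obtain rfl : z = x := le_antisymm (lt_add_one_iff'.1 (hw z hzu hzA)) hxz
  have hzu' := lt_add_one_iff'.1 hzu
  refine ⟨y, hyA, huy', (hA z y hzA hyA (hzu'.trans_lt huy') ?_).trans ?_⟩
  · rintro ⟨v, hvA, hzv, hvy⟩
    rcases le_or_gt v u with hvu | hvu
    · exact absurd (lt_add_one_iff'.1 (hw v (lt_add_one_iff'.2 hvu) hvA)) (not_le.2 hzv)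
    · exact hy v hvy ⟨hvA, hvu⟩
  · gcongr

/-! ### The combinatorial notions in a model -/

/-- `A` has gaps bounded by `d`. -/
def Gaps (A : M.S) (d : M.N) : Prop :=
  ∀ x y, M.mem x A → M.mem y A → x < y → (¬ ∃ z, M.mem z A ∧ x < z ∧ z < y) → y ≤ x + d

/-- `F` is the graph of a strictly increasing function from `{i : i < n}` onto `A`. -/
structure Enumerates (F : M.S) (n : M.N) (A : M.S) : Prop where
  exists_of_mem : ∀ p, M.mem p F → ∃ i x, i < n ∧ M.mem x A ∧ p = code i x
  total : ∀ i < n, ∃ x, M.mem (code i x) F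
  unique : ∀ i x y, M.mem (code i x) F → M.mem (code i y) F → x = y
  onto : ∀ x, M.mem x A → ∃ i, M.mem (code i x) F
  mono : ∀ i j x y, M.mem (code i x) F → M.mem (code j y) F → i < j → x < y

/-- `A` is piecewise syndetic. -/
def PiecewiseSyndetic (A : M.S) : Prop :=
  ∃ d, ∀ n, ∃ H : M.S, (∃ b, ∀ x, M.mem x H → x < b) ∧ (∀ x, M.mem x H → M.mem x A) ∧
    (∃ m, n ≤ m ∧ ∃ F, Enumerates F m H) ∧ Gaps H d

/-- `A` is infinite with bounded gaps. -/
def Syndetic (A : M.S) : Prop := (∀ b, ∃ x, M.mem x A ∧ b ≤ x) ∧ ∃ d, Gaps A d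

/-- `A` contains arbitrarily long intervals. -/
def Thick (A : M.S) : Prop := ∀ n, ∃ a, ∀ i < n, M.mem (a + i) A

/-- `A` is the intersection of a syndetic set and a thick set. -/
def InterSyndeticThick (A : M.S) : Prop :=
  ∃ Y Z : M.S, Syndetic Y ∧ Thick Z ∧ ∀ x, M.mem x A ↔ M.mem x Y ∧ M.mem x Z

section Truth

variable {e : ℕ → M.N} {E : ℕ → M.S}

theorem sat_gapsBounded (X : ℕ) (t : Tm) :
    (gapsBounded X t).sat M.toStr e E ↔ Gaps (E X) (t.eval M.toStr e) := by
  simp [gapsBounded, Gaps]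

theorem sat_hasCard (X : ℕ) (t : Tm) :
    (hasCard X t).sat M.toStr e E ↔ ∃ F, Enumerates F (t.eval M.toStr e) (E X) := by
  simp only [hasCard, Fm.sat_exS]
  refine exists_congr fun F => ?_
  simp only [Fm.sat_and, Fm.sat_all, Fm.sat_imp, Fm.sat_ex, Fm.sat_mem, Fm.sat_eq, sat_lt,
    Tm.eval_shift, eval_pair, eval_var, scons_zero, scons_succ]
  exact ⟨fun ⟨h1, h2, h3, h4, h5⟩ => ⟨h1, h2, h3, h4, h5⟩,
    fun ⟨h1, h2, h3, h4, h5⟩ => ⟨h1, h2, h3, h4, h5⟩⟩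

theorem sat_piecewiseSyndetic (X : ℕ) :
    (piecewiseSyndetic X).sat M.toStr e E ↔ PiecewiseSyndetic (E X) := by
  simp [piecewiseSyndetic, PiecewiseSyndetic, finite, subset, sat_hasCard, sat_gapsBounded]

theorem sat_interSyndeticThick (X : ℕ) :
    (interSyndeticThick X).sat M.toStr e E ↔ InterSyndeticThick (E X) := by
  simp [interSyndeticThick, InterSyndeticThick, syndetic, Syndetic, infinite, thick, Thick,
    isInter, sat_gapsBounded]

end Truth

/-! ### The equivalence -/

/-! ### From piecewise syndetic to an intersection. -/

theorem Enumerates.mem {F A : M.S} {n i x : M.N} (hF : Enumerates F n A)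
    (h : M.mem (code i x) F) : M.mem x A := by
  obtain ⟨j, y, -, hy, hc⟩ := hF.exists_of_mem _ h
  rwa [(code_inj hc).2]

/-- The `i`-th element of a set is at least its first element plus `i`. -/
theorem Enumerates.exists_add_le {F A : M.S} {m b x₀ : M.N} (hF : Enumerates F m A)
    (hb : ∀ x, M.mem x A → x < b) (hx₀ : M.mem (code 0 x₀) F) :
    ∀ i, i < m → ∃ x < b, M.mem (code i x) F ∧ x₀ + i ≤ x := by
  -- The bound `b` on `A` makes the existential quantifier bounded.
  refine induction (.of_formula
    (#0 ≺ #1 ⟹ Fm.bex #2 (pair #1 #0 ∊ 0 ⋏ #4 + #1 ≼ #0))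
    (scons m (scons b fun _ => x₀)) (fun _ => F) (by simp (maxDischargeDepth := 8)) (by simp)) ?_ ?_
  · exact fun _ => ⟨x₀, hb _ (hF.mem hx₀), hx₀, (add_zero x₀).le⟩
  · intro i ih hi
    obtain ⟨x, -, hx, hle⟩ := ih ((lt_succ_self i).trans hi)
    obtain ⟨y, hy⟩ := hF.total _ hi
    refine ⟨y, hb _ (hF.mem hy), hy, ?_⟩
    rw [← add_assoc, add_one_le_iff]
    exact hle.trans_lt (hF.mono _ _ _ _ hx hy (lt_succ_self i))

theorem PiecewiseSyndetic.interSyndeticThick {X : M.S} (h : PiecewiseSyndetic X) :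
    InterSyndeticThick X := by
  obtain ⟨d, h⟩ := h
  obtain ⟨Z, hZ⟩ := comprehension (M := M) (P := fun z => ∃ y < z + d + 1, M.mem y X ∧ z ≤ y)
    (.of_formula (Fm.bex (#0 + #1 + 1) (#0 ∊ 0 ⋏ #1 ≼ #0)) (fun _ => d) (fun _ => X)
      (by simp) (by simp))
  obtain ⟨Y, hY⟩ := comprehension (M := M) (P := fun z => M.mem z X ∨ ¬ M.mem z Z)
    (.of_formula (#0 ∊ 0 ⋎ (#0 ∊ 1).neg) (fun _ => d) (scons X fun _ => Z) (by simp) (by simp))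
  -- If u ∈ Z, the window contains an element of X; otherwise u itself is in Y.
  have key (u : M.N) : ∃ y, M.mem y Y ∧ u ≤ y ∧ y ≤ u + d := by
    by_cases hu : M.mem u Z
    · obtain ⟨y, hy, hyX, huy⟩ := (hZ u).1 hu
      exact ⟨y, (hY y).2 (Or.inl hyX), huy, lt_add_one_iff'.1 hy⟩
    · exact ⟨u, (hY u).2 (Or.inr hu), le_rfl, le_add_of_nonneg_right (zero_le' d)⟩
  refine ⟨Y, Z, ⟨fun b => ?_, 1 + d, fun x y _ hyY hxy hz => ?_⟩, fun n => ?_, fun x => ?_⟩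
  · obtain ⟨y, hy, hby, -⟩ := key b
    exact ⟨y, hy, hby⟩
  -- The window must start beyond `x`, whence the gap bound 1 + d rather than d.
  · obtain ⟨z, hzY, hxz, hzd⟩ := key (x + 1)
    rw [add_assoc] at hzd
    refine le_trans ?_ hzd
    by_contra! hlt
    exact hz ⟨z, hzY, add_one_le_iff.1 hxz, hlt⟩
  -- At least n + 1 elements guarantee one of index n, which is at least x₀ + n; so each x₀ + i with
  -- i < n lies between two elements of `H`.
  · obtain ⟨H, ⟨b, hb⟩, hHX, ⟨m, hnm, F, hF⟩, hgap⟩ := h (n + 1)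
    have hnm' := add_one_le_iff.1 hnm
    obtain ⟨x₀, hx₀⟩ := hF.total 0 ((zero_le' n).trans_lt hnm')
    obtain ⟨x, -, hx, hle⟩ := hF.exists_add_le hb hx₀ n hnm'
    refine ⟨x₀, fun i hi => (hZ _).2 ?_⟩
    obtain ⟨y, hy, hlt, hyd⟩ := exists_mem_of_gaps hgap (hF.mem hx₀)
      (le_add_of_nonneg_right (zero_le' i)) (hF.mem hx) ((add_lt_add_right hi x₀).trans_le hle)
    exact ⟨y, lt_add_one_iff'.2 hyd, hHX y hy, hlt.le⟩
  · refine ⟨fun hx => ⟨(hY x).2 (Or.inl hx), (hZ x).2 ⟨x, ?_, hx, le_rfl⟩⟩, fun ⟨hxY, hxZ⟩ => ?_⟩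
    · exact lt_add_one_iff'.2 (le_add_of_nonneg_right (zero_le' d))
    · exact ((hY x).1 hxY).resolve_right (not_not.2 hxZ)

/-! ### From an intersection to piecewise syndetic. -/

/-- `x` is the first element of `Y` at or above `a + i * l`, and it lies below
`a + (i + 1) * l`. -/
def FirstInBlock (Y : M.S) (a l i x : M.N) : Prop :=
  M.mem x Y ∧ a + i * l ≤ x ∧ x < a + i * l + l ∧ ∀ z < x, a + i * l ≤ z → ¬ M.mem z Y

/-- The formula defining `FirstInBlock`, in the number variables `a`, `l`, `i`, `x` and the set
variable `0`. -/
def firstInBlock (a l i x : ℕ) : Fm :=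
  #x ∊ 0 ⋏ #a + #i * #l ≼ #x ⋏ #x ≺ #a + #i * #l + #l ⋏
    -- Indices in the body go up by one under the quantifier; the bound `#x` is shifted by `Fm.ball`
    -- itself.
    Fm.ball #x (#(a + 1) + #(i + 1) * #(l + 1) ≼ #0 ⟹ (#0 ∊ 0).neg)

theorem isSigma00_firstInBlock (a l i x : ℕ) : IsSigma00 (firstInBlock a l i x) := by
  simp (maxDischargeDepth := 8) [firstInBlock]

theorem sat_firstInBlock {e : ℕ → M.N} {E : ℕ → M.S} (a l i x : ℕ) :
    (firstInBlock a l i x).sat M.toStr e E ↔ FirstInBlock (E 0) (e a) (e l) (e i) (e x) := by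
  simp [firstInBlock, FirstInBlock]

theorem block_le {i j : M.N} (a l : M.N) (h : i < j) : a + i * l + l ≤ a + j * l := by
  have : (i + 1) * l ≤ j * l := mul_le_mul_of_nonneg_right (add_one_le_iff.2 h) (zero_le' l)
  rw [succ_mul] at this
  rw [add_assoc]
  exact add_le_add_right this a

namespace FirstInBlock

variable {Y : M.S} {a l i j x y n : M.N}

theorem lt_bound (h : FirstInBlock Y a l i x) (hi : i < n) : x < a + n * l :=
  h.2.2.1.trans_le (block_le a l hi)

theorem unique (hx : FirstInBlock Y a l i x) (hy : FirstInBlock Y a l i y) : x = y := by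
  rcases lt_trichotomy x y with h | h | h
  · exact (hy.2.2.2 x h hx.2.1 hx.1).elim
  · exact h
  · exact (hx.2.2.2 y h hy.2.1 hy.1).elim

theorem mono (hx : FirstInBlock Y a l i x) (hy : FirstInBlock Y a l j y) (h : i < j) : x < y :=
  (hx.lt_bound h).trans_le hy.2.1

end FirstInBlock

/-- Choosing one element of `Y` in each of `n` consecutive blocks of length `l` gives a set with
`n` elements and gaps bounded by `l + l`. -/
theorem exists_enumerated_subset {Y : M.S} {a l : M.N} (n : M.N)
    (hY : ∀ u, a ≤ u → ∃ y, M.mem y Y ∧ u ≤ y ∧ y < u + l) :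
    ∃ H F : M.S, (∀ x, M.mem x H → M.mem x Y ∧ a ≤ x ∧ x < a + n * l) ∧ Enumerates F n H ∧
      Gaps H (l + l) := by
  have hex (i : M.N) : ∃ x, FirstInBlock Y a l i x := by
    obtain ⟨y, hyY, hy, hyl⟩ := hY (a + i * l) (le_add_of_nonneg_right (zero_le' _))
    obtain ⟨x, hxy, ⟨hxY, hx⟩, hmin⟩ := exists_least (P := fun x => M.mem x Y ∧ a + i * l ≤ x)
      (.of_formula (#0 ∊ 0 ⋏ #1 ≼ #0) (fun _ => a + i * l) (fun _ => Y) (by simp) (by simp))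
      ⟨hyY, hy⟩
    exact ⟨x, hxY, hx, hxy.trans_lt hyl, fun z hz hz' hzY => hmin z hz ⟨hzY, hz'⟩⟩
  obtain ⟨H, hH⟩ := comprehension (M := M) (P := fun x => ∃ i < n, FirstInBlock Y a l i x)
    (.of_formula (Fm.bex #1 (firstInBlock 3 4 0 1)) (scons n (scons a fun _ => l)) (fun _ => Y)
      (by simp (maxDischargeDepth := 8) [isSigma00_firstInBlock]) (by simp [sat_firstInBlock]))
  obtain ⟨F, hF⟩ := comprehension (M := M)
    -- The bound on `x` is automatic for i < n and is stated to make the graph Σ⁰₀.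
    (P := fun p => ∃ i < n, ∃ x < a + n * l, p = code i x ∧ FirstInBlock Y a l i x)
    (.of_formula (Fm.bex #1 (Fm.bex (#3 + #2 * #4) (#2 ≐ pair #1 #0 ⋏ firstInBlock 4 5 1 0)))
      (scons n (scons a fun _ => l)) (fun _ => Y)
      (by simp (maxDischargeDepth := 8) [isSigma00_firstInBlock]) (by simp [sat_firstInBlock]))
  have hcode (i x : M.N) : M.mem (code i x) F ↔ i < n ∧ FirstInBlock Y a l i x := by
    rw [hF]
    constructor
    · rintro ⟨j, hj, y, -, hc, hy⟩
      obtain ⟨rfl, rfl⟩ := code_inj hc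
      exact ⟨hj, hy⟩
    · exact fun ⟨hi, hx⟩ => ⟨i, hi, x, hx.lt_bound hi, rfl, hx⟩
  refine ⟨H, F, fun x hx => ?_, ⟨fun p hp => ?_, fun i hi => ?_, fun i x y hx hy => ?_,
    fun x hx => ?_, fun i j x y hx hy hij => ?_⟩, fun x y hx hy hxy hz => ?_⟩
  · obtain ⟨i, hi, h⟩ := (hH x).1 hx
    exact ⟨h.1, (le_add_of_nonneg_right (zero_le' _)).trans h.2.1, h.lt_bound hi⟩
  · obtain ⟨i, hi, x, -, rfl, hx⟩ := (hF p).1 hp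
    exact ⟨i, x, hi, (hH x).2 ⟨i, hi, hx⟩, rfl⟩
  · exact (hex i).imp fun x hx => (hcode i x).2 ⟨hi, hx⟩
  · exact ((hcode i x).1 hx).2.unique ((hcode i y).1 hy).2
  · obtain ⟨i, hi, h⟩ := (hH x).1 hx
    exact ⟨i, (hcode i x).2 ⟨hi, h⟩⟩
  · exact ((hcode i x).1 hx).2.mono ((hcode j y).1 hy).2 hij
  · obtain ⟨i, hi, hx⟩ := (hH x).1 hx
    obtain ⟨j, hj, hy⟩ := (hH y).1 hy
    have hij : i < j := by
      rcases lt_trichotomy i j with h | rfl | h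
      · exact h
      · exact (hxy.ne (hx.unique hy)).elim
      · exact (hxy.not_gt (hy.mono hx h)).elim
    -- The element `z` chosen in block i + 1 is in `H` because i + 1 ≤ j < n, so it cannot precede
    -- the successor `y` of `x`. It lies below the end of that block, at most 2l beyond `x`.
    obtain ⟨z, hzi⟩ := hex (i + 1)
    have hyz : y ≤ z := by
      by_contra! hlt
      exact hz ⟨z, (hH z).2 ⟨i + 1, (add_one_le_iff.2 hij).trans_lt hj, hzi⟩,
        hx.mono hzi (lt_succ_self i), hlt⟩
    refine hyz.trans (hzi.2.2.1.le.trans ?_)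
    rw [succ_mul, ← add_assoc, add_assoc _ l l]
    exact add_le_add_left hx.2.1 _

theorem InterSyndeticThick.piecewiseSyndetic {X : M.S} (h : InterSyndeticThick X) :
    PiecewiseSyndetic X := by
  obtain ⟨Y, Z, ⟨hinf, d, hgap⟩, hZ, hX⟩ := h
  refine ⟨d + 1 + (d + 1), fun n => ?_⟩
  obtain ⟨y₀, hy₀, -⟩ := hinf 0
  -- Skipping the first `y₀` places of the interval puts every block at or above the element `y₀` of
  -- `Y`, as `exists_mem_of_gaps` requires. It then gives an element of `Y` in (u, u + d], so blocks
  -- of length d + 1 suffice.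
  obtain ⟨c, hc⟩ := hZ (y₀ + n * (d + 1))
  obtain ⟨H, F, hH, hF, hHgap⟩ := exists_enumerated_subset (Y := Y) (a := c + y₀) (l := d + 1) n
    fun u hu => by
      obtain ⟨y₁, hy₁, hle⟩ := hinf (u + 1)
      obtain ⟨y, hyY, huy, hyd⟩ := exists_mem_of_gaps hgap hy₀
        ((le_add_of_nonneg_left (zero_le' c)).trans hu) hy₁ (add_one_le_iff.1 hle)
      exact ⟨y, hyY, huy.le, by rw [← add_assoc]; exact lt_add_one_iff'.2 hyd⟩
  refine ⟨H, ⟨_, fun x hx => (hH x hx).2.2⟩, fun x hx => ?_, ⟨n, le_rfl, F, hF⟩, hHgap⟩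
  obtain ⟨hxY, hcx, hxb⟩ := hH x hx
  obtain ⟨k, rfl⟩ := exists_add_of_le' hcx
  rw [add_assoc, add_assoc] at hxb
  rw [add_assoc] at hxY ⊢
  exact (hX _).2 ⟨hxY, hc _ (lt_of_add_lt_add_left hxb)⟩

end RCAModel
end SecondOrderArith

/-- `RCA₀*` proves: for every set `X`, `X` is piecewise syndetic if and only if `X` is the
intersection of a syndetic set and a thick set. -/
theorem mainTheorem9 :
    SecondOrderArith.Provable SecondOrderArith.RCA0Star
      (SecondOrderArith.Fm.allS
        (SecondOrderArith.Fm.iff (SecondOrderArith.piecewiseSyndetic 0)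
          (SecondOrderArith.interSyndeticThick 0))) := by
  refine SecondOrderArith.provable_of_forall_models fun M hM e E => ?_
  -- The assignment `E` itself witnesses that some set exists.
  let M' : SecondOrderArith.RCAModel := ⟨M, hM, ⟨E 0⟩⟩
  refine SecondOrderArith.Fm.sat_allS.2 fun X => SecondOrderArith.Fm.sat_iff.2 ?_
  exact (SecondOrderArith.RCAModel.sat_piecewiseSyndetic (M := M') 0).trans
    (Iff.trans ⟨fun h => h.interSyndeticThick, fun h => h.piecewiseSyndetic⟩
      (SecondOrderArith.RCAModel.sat_interSyndeticThick (M := M') 0).symm)
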